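/- Let $V$ be a finite-dimensional complex inner product space, $n=\dim_{\mathbb C}V$, and let $K$ be a closed subgroup of the unitary group $U(V)$, acting on the space $\mathbb C[V]$ of holomorphic polynomials on $V$ by $(k.p)(z)=p(k^{-1}z)$. Assume that the action is multiplicity free: $\mathbb C[V]=\bigoplus_{\lambda\in\Lambda}P_\lambda$ with finite-dimensional, $K$-irreducible, pairwise inequivalent subspaces $P_\lambda$. Let $d_\lambda=\dim P_\lambda$ and let $|\lambda|$ be the degree of homogeneity of the elements of $P_\lambda$. On the space of complex-valued polynomial functions on the underlying real space of $V$ consider the Fock inner product $\langle f,g\rangle=\pi^{-n}\int_V f(z)\overline{g(z)}e^{-\langle z,z\rangle}\,dz$. Put $p_\lambda=\frac1{d_\lambda}\sum_{j}v_j\overline{v_j}$, where $(v_j)$ is an orthonormal basis of $P_\lambda$. Order $\Lambda$ linearly, every element having only finitely many predecessors, so that $\alpha$ precedes $\beta$ whenever $|\alpha|<|\beta|$, and let $(q_\lambda)$ be the result of the Gram–Schmidt process applied to $(p_\lambda)$ in this order, normalized by $q_\lambda(0)=1$. The generalized binomial coefficients are the real numbers $\binom{\lambda}{\alpha}$ with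 $$q_\lambda=\sum_{|\alpha|\le|\lambda|}(-1)^{|\alpha|}\binom{\lambda}{\alpha}p_\alpha ,\qquad \binom{\lambda}{\alpha}=0\ \text{ if } |\alpha|>|\lambda|.$$ Define the rates of a pure birth and of a pure death chain on $\Lambda$ by $$q^+(\alpha,\beta)=\begin{cases}\frac{d_\beta}{d_\alpha}\binom{\beta}{\alpha},&|\beta|=|\alpha|+1,\\ -n-|\alpha|,&\alpha=\beta,\\ 0,&\text{otherwise,}\end{cases}\qquad q^-(\alpha,\beta)=\begin{cases}\binom{\alpha}{\beta},&|\alpha|=|\beta|+1,\\ -|\alpha|,&\alpha=\beta,\\ 0,&\text{otherwise.}\end{cases}$$ A transition function on $\Lambda$ is a family $p_t(\alpha,\beta)\ge0$ ($t\ge0$) with $\sum_\beta p_t(\alpha,\beta)\le1$, $p_0(\alpha,\beta)=\delta_{\alpha,\beta}$ and $p_{s+t}(\alpha,\beta)=\sum_\lambda p_s(\alpha,\lambda)p_t(\lambda,\beta)$; it has rates $q$ if $\partial p_t(\alpha,\beta)/\partial t|_{t=0}=q(\alpha,\beta)$ (one-sided derivative) for all $\alpha,\beta$. **Theorem 3.1.**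 There is exactly one transition function $(p^+_t)_{t\ge0}$ with rates $q^+$ and exactly one transition function $(p^-_t)_{t\ge0}$ with rates $q^-$. For both, $\sum_\beta p^\pm_t(\alpha,\beta)=1$ for all $t\ge 0$ and $\alpha\in\Lambda$, and for all $t\ge0$ and $\alpha,\beta\in\Lambda$ $$p_t^+(\alpha,\beta)=\begin{cases}\binom{\beta}{\alpha}\frac{d_\beta}{d_\alpha}(1-e^{-t})^{|\beta|-|\alpha|}(e^{-t})^{|\alpha|+n},&|\beta|\ge|\alpha|,\\0,&\text{otherwise,}\end{cases}$$ $$p_t^-(\alpha,\beta)=\begin{cases}\binom{\alpha}{\beta}e^{-|\beta|t}(1-e^{-t})^{|\alpha|-|\beta|},&|\alpha|\ge|\beta|,\\0,&\text{otherwise,}\end{cases}$$ with the convention $0^0=1$. -/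

import Mathlib

open MeasureTheory Module

noncomputable section

namespace MultFree

section Polynomials

variable (V : Type*) [NormedAddCommGroup V] [InnerProductSpace ℂ V]

/-- The algebra `ℂ[V_ℝ]` of complex valued polynomial functions on the real vector space underlying
`V`: the algebra of functions generated by the constants and the real-linear functionals. -/
def realPolyAlg : Subalgebra ℂ (V → ℂ) :=
  Algebra.adjoin ℂ (Set.range fun φ : V →L[ℝ] ℂ => (φ : V → ℂ))

/-- The algebra `ℂ[V]` of holomorphic polynomial functions on `V`: the algebra of functions
generated by the constants and the complex-linear functionals. -/
def holPolyAlg : Subalgebra ℂ (V → ℂ) :=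
  Algebra.adjoin ℂ (Set.range fun φ : V →L[ℂ] ℂ => (φ : V → ℂ))

/-- `ℂ[V_ℝ]` as a type of its own (so that it carries the topology of the Fock norm only). -/
def RealPoly : Type _ := realPolyAlg V

instance : CommRing (RealPoly V) := inferInstanceAs (CommRing (realPolyAlg V))

instance : Algebra ℂ (RealPoly V) := inferInstanceAs (Algebra ℂ (realPolyAlg V))

variable {V}

instance : FunLike (RealPoly V) V ℂ where
  coe := fun f : realPolyAlg V => (f : V → ℂ)
  coe_injective := Subtype.coe_injective

namespace RealPoly

/-- A polynomial function as an element of `RealPoly V`. -/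
def mk (f : V → ℂ) (hf : f ∈ realPolyAlg V) : RealPoly V := (⟨f, hf⟩ : realPolyAlg V)

@[simp] theorem mk_apply (f : V → ℂ) (hf : f ∈ realPolyAlg V) (z : V) : mk f hf z = f z := rfl

theorem mem (f : RealPoly V) : (f : V → ℂ) ∈ realPolyAlg V := Subtype.property (p := _) f

@[ext] theorem ext {f g : RealPoly V} (h : ∀ z, f z = g z) : f = g := DFunLike.ext _ _ h

@[simp] theorem add_apply (f g : RealPoly V) (z : V) : (f + g) z = f z + g z := rfl

@[simp] theorem mul_apply (f g : RealPoly V) (z : V) : (f * g) z = f z * g z := rfl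

@[simp] theorem smul_apply (c : ℂ) (f : RealPoly V) (z : V) : (c • f) z = c * f z := rfl

@[simp] theorem zero_apply (z : V) : (0 : RealPoly V) z = 0 := rfl

theorem comp_mem {f : V → ℂ} (hf : f ∈ realPolyAlg V) (T : V →L[ℝ] V) :
    (fun z => f (T z)) ∈ realPolyAlg V := by
  unfold realPolyAlg at hf
  induction hf using Algebra.adjoin_induction with
  | mem x hx =>
    obtain ⟨φ, rfl⟩ := hx
    exact Algebra.subset_adjoin ⟨φ.comp T, rfl⟩
  | algebraMap r => exact (realPolyAlg V).algebraMap_mem r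
  | add x y _ _ hx hy => exact (realPolyAlg V).add_mem hx hy
  | mul x y _ _ hx hy => exact (realPolyAlg V).mul_mem hx hy

theorem conj_mem {f : V → ℂ} (hf : f ∈ realPolyAlg V) :
    (fun z => (starRingEnd ℂ) (f z)) ∈ realPolyAlg V := by
  unfold realPolyAlg at hf
  induction hf using Algebra.adjoin_induction with
  | mem x hx =>
    obtain ⟨φ, rfl⟩ := hx
    exact Algebra.subset_adjoin ⟨(Complex.conjCLE : ℂ →L[ℝ] ℂ).comp φ, rfl⟩
  | algebraMap r => exact (realPolyAlg V).algebraMap_mem ((starRingEnd ℂ) r)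
  | add x y _ _ hx hy =>
    convert (realPolyAlg V).add_mem hx hy using 1
    ext z; simp
  | mul x y _ _ hx hy =>
    convert (realPolyAlg V).mul_mem hx hy using 1
    ext z; simp

/-- The complex conjugate of a polynomial function. -/
def conj (f : RealPoly V) : RealPoly V := mk _ (conj_mem f.mem)

@[simp] theorem conj_apply (f : RealPoly V) (z : V) : conj f z = (starRingEnd ℂ) (f z) := rfl

theorem continuous (f : RealPoly V) : Continuous (fun z => f z) := by
  have hf := f.mem
  generalize (f : V → ℂ) = f at hf
  unfold realPolyAlg at hf
  induction hf using Algebra.adjoin_induction with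
  | mem x hx => obtain ⟨φ, rfl⟩ := hx; exact φ.continuous
  | algebraMap r => exact continuous_const
  | add x y _ _ hx hy => exact hx.add hy
  | mul x y _ _ hx hy => exact hx.mul hy

theorem exists_bound (f : RealPoly V) :
    ∃ (C : ℝ) (k : ℕ), 0 ≤ C ∧ ∀ z, ‖f z‖ ≤ C * (1 + ‖z‖) ^ k := by
  have hf := f.mem
  generalize (f : V → ℂ) = f at hf
  unfold realPolyAlg at hf
  induction hf using Algebra.adjoin_induction with
  | mem x hx =>
    obtain ⟨φ, rfl⟩ := hx
    refine ⟨‖φ‖, 1, norm_nonneg _, fun z => ?_⟩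
    refine (φ.le_opNorm z).trans ?_
    gcongr
    simp
  | algebraMap r => exact ⟨‖r‖, 0, norm_nonneg _, fun z => by simp⟩
  | add x y _ _ hx hy =>
    obtain ⟨C, k, hC, h⟩ := hx
    obtain ⟨D, l, hD, h'⟩ := hy
    refine ⟨C + D, k + l, by positivity, fun z => ?_⟩
    have h1 : (1 : ℝ) ≤ 1 + ‖z‖ := by simp
    calc ‖(x + y) z‖ ≤ ‖x z‖ + ‖y z‖ := norm_add_le _ _
      _ ≤ C * (1 + ‖z‖) ^ k + D * (1 + ‖z‖) ^ l := add_le_add (h z) (h' z)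
      _ ≤ C * (1 + ‖z‖) ^ (k + l) + D * (1 + ‖z‖) ^ (k + l) := by
        gcongr <;> first | exact h1 | omega
      _ = _ := by ring
  | mul x y _ _ hx hy =>
    obtain ⟨C, k, hC, h⟩ := hx
    obtain ⟨D, l, hD, h'⟩ := hy
    refine ⟨C * D, k + l, by positivity, fun z => ?_⟩
    calc ‖(x * y) z‖ = ‖x z‖ * ‖y z‖ := norm_mul _ _
      _ ≤ (C * (1 + ‖z‖) ^ k) * (D * (1 + ‖z‖) ^ l) := by
        gcongr
        · exact h z
        · exact h' z
      _ = _ := by ring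

end RealPoly

/-- Holomorphic polynomials, as a subspace of `ℂ[V_ℝ]`. -/
def holPoly : Submodule ℂ (RealPoly V) where
  carrier := {f | (f : V → ℂ) ∈ holPolyAlg V}
  add_mem' := fun hf hg => (holPolyAlg V).add_mem hf hg
  zero_mem' := (holPolyAlg V).zero_mem
  smul_mem' := fun c _ hf => (holPolyAlg V).smul_mem hf c

/-- Homogeneous holomorphic polynomials of degree `m`. -/
def homogPoly (m : ℕ) : Submodule ℂ (RealPoly V) where
  carrier := {f | f ∈ holPoly (V := V) ∧ ∀ (c : ℂ) (z : V), f (c • z) = c ^ m * f z}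
  add_mem' := by
    rintro f g ⟨hf, hf'⟩ ⟨hg, hg'⟩
    exact ⟨holPoly.add_mem hf hg, fun c z => by simp [hf', hg', mul_add]⟩
  zero_mem' := ⟨holPoly.zero_mem, fun c z => by simp⟩
  smul_mem' := by
    rintro a f ⟨hf, hf'⟩
    exact ⟨holPoly.smul_mem a hf, fun c z => by simp [hf', mul_left_comm]⟩

end Polynomials

section Fock

variable {V : Type*} [NormedAddCommGroup V] [InnerProductSpace ℂ V] [FiniteDimensional ℂ V]
  [MeasurableSpace V] [BorelSpace V]

variable (V) in
/-- Lebesgue measure on the real vector space underlying `V`, normalized by the real Euclidean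
structure `re ⟨·, ·⟩`. -/
def lebesgue : Measure V :=
  letI : InnerProductSpace ℝ V := InnerProductSpace.rclikeToReal ℂ V
  volume

instance : (lebesgue V).IsAddHaarMeasure :=
  let : InnerProductSpace ℝ V := InnerProductSpace.rclikeToReal ℂ V
  inferInstanceAs (volume : Measure V).IsAddHaarMeasure

/-- The Fock inner product
`⟨f, g⟩₁ = π⁻ⁿ ∫ f(z) conj(g(z)) exp(-⟨z, z⟩) dz`, with `n = dim_ℂ V` and `dz` Lebesgue measure on
the real Euclidean space underlying `V`. -/
def fock (f g : RealPoly V) : ℂ :=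
  ((Real.pi : ℂ)⁻¹) ^ finrank ℂ V *
    ∫ z : V, f z * (starRingEnd ℂ) (g z) * (Real.exp (-‖z‖ ^ 2) : ℂ) ∂(lebesgue V)

theorem integrable_gauss (f : RealPoly V) :
    Integrable (fun z : V => f z * (Real.exp (-‖z‖ ^ 2) : ℂ)) (lebesgue V) := by
  obtain ⟨C, k, hC, h⟩ := f.exists_bound
  have hi : Integrable (fun z : V => Real.exp (-(1 / 2) * ‖z‖ ^ 2))
      (lebesgue V) := by
    let : InnerProductSpace ℝ V := InnerProductSpace.rclikeToReal ℂ V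
    change Integrable _ volume
    have := GaussianFourier.integrable_cexp_neg_mul_sq_norm_add (V := V) (b := (1 / 2 : ℂ))
      (by norm_num) 0 0
    refine this.norm.congr (Filter.Eventually.of_forall fun z => ?_)
    simp only [zero_mul, add_zero, Complex.norm_exp]
    congr 1
    have : (-(1 / 2 : ℂ) * (‖z‖ : ℂ) ^ 2) = ((-(1 / 2) * ‖z‖ ^ 2 : ℝ) : ℂ) := by push_cast; ring
    rw [this, Complex.ofReal_re]
  have hb : ∃ M : ℝ, ∀ x : ℝ, 0 ≤ x → (1 + x) ^ k * Real.exp (-(1 / 2) * x ^ 2) ≤ M := by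
    refine ⟨k.factorial * Real.exp 2, fun x hx => ?_⟩
    have h1 : (1 + x) ^ k / k.factorial ≤ Real.exp (1 + x) :=
      Real.pow_div_factorial_le_exp _ (by positivity) k
    have h2 : (1 + x) ^ k ≤ k.factorial * Real.exp (1 + x) := by
      rw [div_le_iff₀ (by positivity)] at h1
      linarith
    calc (1 + x) ^ k * Real.exp (-(1 / 2) * x ^ 2)
        ≤ (k.factorial * Real.exp (1 + x)) * Real.exp (-(1 / 2) * x ^ 2) := by gcongr
      _ = k.factorial * Real.exp (1 + x + -(1 / 2) * x ^ 2) := by rw [mul_assoc, ← Real.exp_add]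
      _ ≤ k.factorial * Real.exp 2 := by
        gcongr
        nlinarith [sq_nonneg (x - 1)]
  obtain ⟨M, hM⟩ := hb
  refine (hi.const_mul (C * M)).mono' ?_ (Filter.Eventually.of_forall fun z => ?_)
  · refine Continuous.aestronglyMeasurable ?_
    have := f.continuous
    fun_prop
  · have h3 : Real.exp (-‖z‖ ^ 2)
        = Real.exp (-(1 / 2) * ‖z‖ ^ 2) * Real.exp (-(1 / 2) * ‖z‖ ^ 2) := by
      rw [← Real.exp_add]; ring_nf
    rw [norm_mul, Complex.norm_real, Real.norm_eq_abs, abs_of_pos (Real.exp_pos _), h3, ← mul_assoc]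
    refine mul_le_mul_of_nonneg_right ?_ (Real.exp_pos _).le
    calc ‖f z‖ * Real.exp (-(1 / 2) * ‖z‖ ^ 2)
        ≤ (C * (1 + ‖z‖) ^ k) * Real.exp (-(1 / 2) * ‖z‖ ^ 2) := by
          gcongr
          exact h z
      _ = C * ((1 + ‖z‖) ^ k * Real.exp (-(1 / 2) * ‖z‖ ^ 2)) := by ring
      _ ≤ C * M := by
          gcongr
          exact hM _ (norm_nonneg _)

theorem integrable_fock (f g : RealPoly V) :
    Integrable (fun z : V => f z * (starRingEnd ℂ) (g z) * (Real.exp (-‖z‖ ^ 2) : ℂ)) (lebesgue V) :=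
  integrable_gauss (f * g.conj)

theorem fock_self (f : RealPoly V) :
    fock f f = ((Real.pi⁻¹ ^ finrank ℂ V * ∫ z : V, ‖f z‖ ^ 2 * Real.exp (-‖z‖ ^ 2) ∂(lebesgue V) : ℝ) :
      ℂ) := by
  unfold fock
  push_cast
  congr 1
  rw [← integral_complex_ofReal]
  congr 1
  ext z
  rw [Complex.mul_conj, Complex.normSq_eq_norm_sq]
  push_cast
  ring

/-- The Fock inner product is a positive definite Hermitian form on `ℂ[V_ℝ]`.
(Mathlib's inner products are linear in the second variable, hence the swap.) -/
@[reducible]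
def fockCore : InnerProductSpace.Core ℂ (RealPoly V) where
  inner f g := fock g f
  conj_inner_symm f g := by
    unfold fock
    rw [map_mul, ← integral_conj]
    congr 1
    · simp
    · congr 1
      ext z
      simp only [map_mul, Complex.conj_conj, Complex.conj_ofReal]
      ring
  re_inner_nonneg f := by
    rw [fock_self]
    simp only [RCLike.re_to_complex, Complex.ofReal_re]
    have : 0 ≤ ∫ z : V, ‖f z‖ ^ 2 * Real.exp (-‖z‖ ^ 2) ∂(lebesgue V) :=
      integral_nonneg fun z => by positivity
    have := Real.pi_pos
    positivity
  add_left f g h := by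
    unfold fock
    rw [← mul_add, ← integral_add (integrable_fock _ _) (integrable_fock _ _)]
    congr 2
    ext z
    simp only [RealPoly.add_apply, map_add]
    ring
  smul_left f g c := by
    unfold fock
    rw [mul_left_comm, ← integral_const_mul ((starRingEnd ℂ) c)]
    congr 2
    funext z
    simp only [RealPoly.smul_apply, map_mul]
    ring
  definite f hf := by
    rw [fock_self, Complex.ofReal_eq_zero, mul_eq_zero] at hf
    have hf := hf.resolve_left (by have := Real.pi_pos; positivity)
    have hc : Continuous fun z : V => ‖f z‖ ^ 2 * Real.exp (-‖z‖ ^ 2) := by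
      have := f.continuous
      fun_prop
    have hi : Integrable (fun z : V => ‖f z‖ ^ 2 * Real.exp (-‖z‖ ^ 2)) (lebesgue V) := by
      refine (integrable_fock f f).norm.congr (Filter.Eventually.of_forall fun z => ?_)
      change ‖f z * (starRingEnd ℂ) (f z) * (Real.exp (-‖z‖ ^ 2) : ℂ)‖ = _
      rw [norm_mul, norm_mul, Complex.norm_real, Real.norm_eq_abs, abs_of_pos (Real.exp_pos _),
        RCLike.norm_conj, ← sq]
    rw [integral_eq_zero_iff_of_nonneg (fun z => by positivity) hi] at hf
    have h0 := (hc.ae_eq_iff_eq (lebesgue V) continuous_const).1 hf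
    ext z
    have h1 : ‖f z‖ ^ 2 * Real.exp (-‖z‖ ^ 2) = 0 := congrFun h0 z
    simpa [(Real.exp_pos _).ne'] using h1

instance : NormedAddCommGroup (RealPoly V) := fockCore.toNormedAddCommGroup

instance : InnerProductSpace ℂ (RealPoly V) := InnerProductSpace.ofCore fockCore.toCore

end Fock

section Action

variable {V : Type*} [NormedAddCommGroup V] [InnerProductSpace ℂ V] [CompleteSpace V]

/-- The representation `(k.p)(z) = p(k⁻¹.z)` of a group `K` of unitary operators on `V` on
polynomial functions. -/
def polyRep (K : Subgroup (unitary (V →L[ℂ] V))) : Representation ℂ K (RealPoly V) where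
  toFun k :=
    { toFun := fun f => RealPoly.mk (fun z => f (((k⁻¹ : K) : V →L[ℂ] V) z))
        (RealPoly.comp_mem f.mem (((k⁻¹ : K) : V →L[ℂ] V).restrictScalars ℝ))
      map_add' := fun _ _ => rfl
      map_smul' := fun _ _ => rfl }
  map_one' := by
    ext f z
    change f (((1⁻¹ : K) : V →L[ℂ] V) z) = f z
    simp
  map_mul' k l := by
    ext f z
    change f ((((k * l)⁻¹ : K) : V →L[ℂ] V) z)
      = f (((l⁻¹ : K) : V →L[ℂ] V) (((k⁻¹ : K) : V →L[ℂ] V) z))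
    simp

/-- A decomposition `ℂ[V] = ⨁_{λ ∈ Λ} P_λ` into finite-dimensional, irreducible, pairwise
inequivalent `K`-invariant subspaces. The action of `K` on `V` is multiplicity free precisely when
there is such a decomposition. -/
structure MultFreeDecomposition (K : Subgroup (unitary (V →L[ℂ] V))) (Λ : Type*) where
  /-- the summands `P_λ` -/
  P : Λ → Subrepresentation (polyRep K)
  finiteDimensional : ∀ a, FiniteDimensional ℂ (P a).toSubmodule
  irreducible : ∀ a, (P a).toRepresentation.IsIrreducible
  independent : iSupIndep fun a => (P a).toSubmodule
  iSup_eq : ⨆ a, (P a).toSubmodule = holPoly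
  inequivalent : ∀ a b, a ≠ b →
    IsEmpty (Representation.Equiv (P a).toRepresentation (P b).toRepresentation)

namespace MultFreeDecomposition

variable {K : Subgroup (unitary (V →L[ℂ] V))} {Λ : Type*} (D : MultFreeDecomposition K Λ)

instance (a : Λ) : FiniteDimensional ℂ (D.P a).toSubmodule := D.finiteDimensional a

/-- `d_λ`, the dimension of `P_λ`. -/
def dim (a : Λ) : ℕ := finrank ℂ (D.P a).toSubmodule

/-- `|λ|`, the degree of homogeneity of the polynomials in `P_λ`. -/
def deg (a : Λ) : ℕ := sInf {m | (D.P a).toSubmodule ≤ homogPoly m}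

variable [FiniteDimensional ℂ V] [MeasurableSpace V] [BorelSpace V]

/-- `p_λ = d_λ⁻¹ ∑_j v_j conj(v_j)`, with `v` an orthonormal basis of `P_λ` for the
Fock inner product. -/
def p (a : Λ) : RealPoly V :=
  let v := stdOrthonormalBasis ℂ (D.P a).toSubmodule
  (D.dim a : ℂ)⁻¹ • ∑ j, (v j : RealPoly V) * RealPoly.conj (v j : RealPoly V)

variable [LinearOrder Λ] [LocallyFiniteOrderBot Λ] [WellFoundedLT Λ]

/-- `q_λ`: the result of the Gram-Schmidt process applied to the family `p` in the order of `Λ`,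
normalized by `q_λ(0) = 1`. -/
def q (a : Λ) : RealPoly V :=
  (InnerProductSpace.gramSchmidt ℂ D.p a (0 : V))⁻¹ • InnerProductSpace.gramSchmidt ℂ D.p a

theorem exists_expansion (a : Λ) :
    ∃ c : Λ →₀ ℂ, (∀ b ∈ c.support, b ≤ a) ∧ D.q a = c.sum fun b x => x • D.p b := by
  have h : D.q a ∈ Submodule.span ℂ (D.p '' Set.Iic a) := by
    refine Submodule.smul_mem _ _ ?_
    exact InnerProductSpace.gramSchmidt_mem_span ℂ D.p le_rfl
  obtain ⟨c, hc, h⟩ := (Finsupp.mem_span_image_iff_linearCombination ℂ).1 h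
  exact ⟨c, fun b hb => hc hb, h.symm⟩

/-- The coefficients of `q_λ` in the family `p`. -/
def coeff (a : Λ) : Λ →₀ ℂ := (D.exists_expansion a).choose

/-- The generalized binomial coefficient `C(λ, α)`: the real number such that
`q_λ = ∑_{|α| ≤ |λ|} (-1)^|α| C(λ, α) p_α`, and `0` if `|α| > |λ|`. -/
def binom (a b : Λ) : ℝ :=
  if D.deg b ≤ D.deg a then (-1) ^ D.deg b * (D.coeff a b).re else 0

/-- The transition rates `q⁺(α, β)` of the pure birth chain. -/
def birthRate (a b : Λ) : ℝ :=
  if D.deg b = D.deg a + 1 then (D.dim b : ℝ) / D.dim a * D.binom b a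
  else if a = b then -(finrank ℂ V : ℝ) - D.deg a
  else 0

/-- The transition rates `q⁻(α, β)` of the pure death chain. -/
def deathRate (a b : Λ) : ℝ :=
  if D.deg a = D.deg b + 1 then D.binom a b
  else if a = b then -(D.deg a : ℝ)
  else 0

/-- The explicit birth semigroup. -/
def birthFormula (t : ℝ) (a b : Λ) : ℝ :=
  if D.deg a ≤ D.deg b then
    D.binom b a * ((D.dim b : ℝ) / D.dim a) * (1 - Real.exp (-t)) ^ (D.deg b - D.deg a)
      * Real.exp (-t) ^ (D.deg a + finrank ℂ V)
  else 0

/-- The explicit death semigroup. -/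
def deathFormula (t : ℝ) (a b : Λ) : ℝ :=
  if D.deg b ≤ D.deg a then
    D.binom a b * Real.exp (-(D.deg b : ℝ) * t) * (1 - Real.exp (-t)) ^ (D.deg a - D.deg b)
  else 0

end MultFreeDecomposition

end Action

section Chains

variable {S : Type*}

/-- `p t x y`, for `t ≥ 0`, is a transition function on the discrete state space `S`: nonnegative,
with row sums at most `1`, `p 0` the identity, and the semigroup (Chapman-Kolmogorov) property.
(Values at negative times play no role.) -/
structure IsTransitionFunction (p : ℝ → S → S → ℝ) : Prop where
  nonneg : ∀ t, 0 ≤ t → ∀ x y, 0 ≤ p t x y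
  summable : ∀ t, 0 ≤ t → ∀ x, Summable (p t x)
  tsum_le_one : ∀ t, 0 ≤ t → ∀ x, ∑' y, p t x y ≤ 1
  zero_self : ∀ x, p 0 x x = 1
  zero_ne : ∀ x y, x ≠ y → p 0 x y = 0
  semigroup : ∀ s t, 0 ≤ s → 0 ≤ t → ∀ x y,
    HasSum (fun u => p s x u * p t u y) (p (s + t) x y)

/-- The semigroup of transition probabilities of a (non-explosive) Markov chain: a transition
function all of whose row sums are `1`. -/
structure IsTransitionSemigroup (p : ℝ → S → S → ℝ) : Prop extends IsTransitionFunction p where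
  hasSum_one : ∀ t, 0 ≤ t → ∀ x, HasSum (p t x) 1

/-- `p` has transition rates `r`: `r x y` is the (one-sided) derivative of `p t x y` at `t = 0`. -/
def HasTransitionRates (p : ℝ → S → S → ℝ) (r : S → S → ℝ) : Prop :=
  ∀ x y, HasDerivWithinAt (fun t => p t x y) (r x y) (Set.Ici 0) 0

end Chains

end MultFree

end

/-!
The binomial coefficients of a multiplicity free action are the matrix entries of the powers of a
single operator, the Laplacian `Δ = ∑ ∂_i ∂̄_i` on `ℂ[V_ℝ]`, and both chains are read off from it.

Integration by parts against the Gaussian shows that `z_a - ∂̄_a` is adjoint to `∂_a` for the Fock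
inner product (`fock_coord_mul_sub_delBar`). The operator `e^{-Δ}` (`heat`) turns multiplication by
`z_a` into `z_a - ∂̄_a`, so for the inner product `⟨e^{-Δ} F, e^{-Δ} G⟩` (`fischer`) the adjoint of
`∂_a` is multiplication by `z_a`, on polynomials in both `z` and `z̄`. On products `f ḡ` this is the
tensor product of the Fock inner products (`fischer_mul_conj`), and the adjoint of `Δ` is
multiplication by `⟨z, z⟩`.

Schur's lemma for invariant sesquilinear forms on `P_a × P_b` shows that the summands are orthogonal
and homogeneous, that `⟨p_a, p_b⟩ = δ_{a,b} / d_a` for `fischer`, and that the `p_b` with `|b| = m`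
span the invariants of bidegree `(m, m)` (`eq_sum_p`). Hence the `e^{-Δ} p_a` are orthogonal and
unitriangular in the `p_b`: they are the result of the Gram-Schmidt process (`gramSchmidt_p`).
Comparing coefficients, `Δ^k p_a / k! = ∑ C(a, b) p_b` and
`⟨z, z⟩^k p_a / k! = ∑ (d_b / d_a) C(b, a) p_b`, with sums over `|b| = |a| ∓ k`.

Everything needed about the coefficients follows. They are nonnegative since `Δ` preserves sums of
squares `|f|²`; the semigroup property is `Δ^j Δ^k = Δ^{j+k}` together with the binomial theorem;
the row sums come from the Gaussian expectation, which is `1` at each `p_a`, is multiplied by `m`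
under `Δ` and by `n + m` under `⟨z, z⟩` in bidegree `(m, m)`.

For uniqueness, any transition function with the given rates satisfies the forward inequality, so
by induction along the chain it dominates the explicit one (`IsTransitionFunction.le_of_forward`);
as the latter already has row sums `1`, they agree.
-/

noncomputable section

namespace MultFree

/-! ### Uniqueness of transition functions -/

section Uniqueness

open Filter Topology Set

variable {S : Type*} {p P : ℝ → S → S → ℝ} {r : S → S → ℝ}

theorem IsTransitionFunction.sum_le (hp : IsTransitionFunction p) {s h : ℝ} (hs : 0 ≤ s)
    (hh : 0 ≤ h) (F : Finset S) (x y : S) : ∑ u ∈ F, p s x u * p h u y ≤ p (s + h) x y :=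
  sum_le_hasSum F (fun u _ => mul_nonneg (hp.nonneg s hs x u) (hp.nonneg h hh u y))
    (hp.semigroup s h hs hh x y)

theorem IsTransitionFunction.le_one (hp : IsTransitionFunction p) {t : ℝ} (ht : 0 ≤ t) (x y : S) :
    p t x y ≤ 1 :=
  ((hp.summable t ht x).le_tsum y fun u _ => hp.nonneg t ht x u).trans (hp.tsum_le_one t ht x)

theorem IsTransitionFunction.abs_sub_le (hp : IsTransitionFunction p) {s h : ℝ} (hs : 0 ≤ s)
    (hh : 0 ≤ h) (x y : S) : |p (h + s) x y - p s x y| ≤ 1 - p h x x := by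
  classical
  have h1 := hp.le_one hh x x
  have h2 := hp.le_one hs x y
  have h3 := hp.nonneg s hs x y
  have h4 := hp.nonneg h hh x x
  have lower := hp.sum_le hh hs {x} x y
  rw [Finset.sum_singleton] at lower
  have upper : p (h + s) x y ≤ ∑' u, p h x u - p h x x * (1 - p s x y) := by
    refine hasSum_le (fun u => ?_) (hp.semigroup h s hh hs x y)
      ((hp.summable h hh x).hasSum.sub (hasSum_ite_eq x (p h x x * (1 - p s x y))))
    by_cases hu : u = x
    · subst hu
      simp only [if_true]
      linarith
    · simp only [hu, if_false, sub_zero]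
      exact mul_le_of_le_one_right (hp.nonneg h hh x u) (hp.le_one hs u y)
  have h5 := hp.tsum_le_one h hh x
  rw [abs_le]
  constructor <;> nlinarith

theorem HasTransitionRates.tendsto_self (hr : HasTransitionRates p r)
    (hp : IsTransitionFunction p) (x : S) :
    Tendsto (fun t => p t x x) (𝓝[≥] 0) (𝓝 1) := by
  have := (hr x x).continuousWithinAt
  rwa [ContinuousWithinAt, hp.zero_self] at this

theorem HasTransitionRates.continuousOn (hr : HasTransitionRates p r)
    (hp : IsTransitionFunction p) (x y : S) : ContinuousOn (fun t => p t x y) (Ici 0) := by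
  intro t ht
  rw [ContinuousWithinAt, tendsto_iff_dist_tendsto_zero]
  have h1 : Tendsto (fun s : ℝ => |s - t|) (𝓝[Ici 0] t) (𝓝[≥] 0) := by
    refine tendsto_nhdsWithin_iff.2 ⟨?_, Eventually.of_forall fun s => Set.mem_Ici.2 (abs_nonneg _)⟩
    have : Tendsto (fun s : ℝ => |s - t|) (𝓝 t) (𝓝 |t - t|) := by
      have : Continuous fun s : ℝ => |s - t| := by fun_prop
      exact this.tendsto t
    rw [sub_self, abs_zero] at this
    exact this.mono_left nhdsWithin_le_nhds
  have h2 := ((hr.tendsto_self hp x).comp h1).const_sub 1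
  rw [sub_self] at h2
  refine squeeze_zero' (Eventually.of_forall fun s => dist_nonneg) ?_ h2
  filter_upwards [self_mem_nhdsWithin] with s hs
  rw [Real.dist_eq]
  rcases le_total s t with hst | hst
  · have := hp.abs_sub_le hs (sub_nonneg.2 hst) x y
    rw [sub_add_cancel] at this
    rwa [abs_sub_comm, Function.comp_apply, abs_sub_comm s t, abs_of_nonneg (sub_nonneg.2 hst)]
  · have := hp.abs_sub_le ht (sub_nonneg.2 hst) x y
    rw [sub_add_cancel] at this
    rwa [Function.comp_apply, abs_of_nonneg (sub_nonneg.2 hst)]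

theorem HasTransitionRates.nonneg_of_ne (hr : HasTransitionRates p r)
    (hp : IsTransitionFunction p) {x y : S} (hxy : x ≠ y) : 0 ≤ r x y := by
  have h := (hasDerivWithinAt_iff_tendsto_slope' self_notMem_Ioi).1
    ((hr x y).mono Ioi_subset_Ici_self)
  refine ge_of_tendsto h ?_
  filter_upwards [self_mem_nhdsWithin] with t ht
  have ht : (0 : ℝ) < t := ht
  rw [slope_def_field, hp.zero_ne x y hxy, sub_zero, sub_zero]
  exact div_nonneg (hp.nonneg t ht.le x y) ht.le

theorem HasTransitionRates.self_nonpos (hr : HasTransitionRates p r)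
    (hp : IsTransitionFunction p) (x : S) : r x x ≤ 0 := by
  have h := (hasDerivWithinAt_iff_tendsto_slope' self_notMem_Ioi).1
    ((hr x x).mono Ioi_subset_Ici_self)
  refine le_of_tendsto h ?_
  filter_upwards [self_mem_nhdsWithin] with t ht
  have ht : (0 : ℝ) < t := ht
  rw [slope_def_field, hp.zero_self x, sub_zero]
  exact div_nonpos_of_nonpos_of_nonneg (sub_nonpos.2 (hp.le_one ht.le x x)) ht.le

/-- The rates are the limits of `(p_h(u, y) - δ_{u,y}) / h` as `h` decreases to `0`. -/
theorem HasTransitionRates.tendsto_div [DecidableEq S] (hr : HasTransitionRates p r)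
    (hp : IsTransitionFunction p) (u y : S) :
    Tendsto (fun h => (p h u y - if u = y then 1 else 0) / h) (𝓝[>] 0) (𝓝 (r u y)) := by
  have h := (hasDerivWithinAt_iff_tendsto_slope' self_notMem_Ioi).1
    ((hr u y).mono Ioi_subset_Ici_self)
  refine h.congr fun t => ?_
  rw [slope_def_field, sub_zero]
  congr 2
  split_ifs with h
  · rw [h, hp.zero_self]
  · exact hp.zero_ne u y h

/-- The difference of two transition functions with the same rates satisfies the forward
differential inequality `φ' ≥ r(y, y) φ`, provided that the first one already dominates the second
at the states that feed `y`; hence it stays nonnegative. -/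
theorem IsTransitionFunction.le_of_forward (hP : IsTransitionFunction P)
    (hPr : HasTransitionRates P r) (hp : IsTransitionFunction p) (hpr : HasTransitionRates p r)
    {x y : S} (F : Finset S) (hy : y ∈ F)
    (hF : ∀ s h, 0 ≤ s → 0 ≤ h → P (s + h) x y = ∑ u ∈ F, P s x u * P h u y)
    (hle : ∀ u ∈ F, u ≠ y → r u y ≠ 0 → ∀ t, 0 ≤ t → P t x u ≤ p t x u) :
    ∀ t, 0 ≤ t → P t x y ≤ p t x y := by
  classical
  intro T hT
  -- The lower right derivative of `P - p` is at most `r(y, y) (P - p)`.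
  have key : ∀ s, 0 ≤ s → ∀ c, r y y * (P s x y - p s x y) < c →
      ∃ᶠ z in 𝓝[>] s, slope (fun t => P t x y - p t x y) s z < c := by
    intro s hs c hc
    have hlim : Tendsto (fun h => ∑ u ∈ F,
        (P s x u * ((P h u y - if u = y then 1 else 0) / h)
          - p s x u * ((p h u y - if u = y then 1 else 0) / h)))
        (𝓝[>] 0) (𝓝 (∑ u ∈ F, (P s x u * r u y - p s x u * r u y))) :=
      tendsto_finsetSum _ fun u _ =>
        ((hPr.tendsto_div hP u y).const_mul _).sub ((hpr.tendsto_div hp u y).const_mul _)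
    have hsum : ∑ u ∈ F, (P s x u * r u y - p s x u * r u y) < c := by
      refine lt_of_le_of_lt ?_ hc
      rw [← Finset.add_sum_erase F _ hy]
      have : ∑ u ∈ F.erase y, (P s x u * r u y - p s x u * r u y) ≤ 0 := by
        refine Finset.sum_nonpos fun u hu => ?_
        obtain ⟨huy, hu⟩ := Finset.mem_erase.1 hu
        by_cases h0 : r u y = 0
        · simp [h0]
        · rw [← sub_mul]
          exact mul_nonpos_of_nonpos_of_nonneg (sub_nonpos.2 (hle u hu huy h0 s hs))
            (hpr.nonneg_of_ne hp huy)
      linarith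
    have hev := hlim.eventually (gt_mem_nhds hsum)
    have hshift : Tendsto (fun z : ℝ => z - s) (𝓝[>] s) (𝓝[>] 0) := by
      refine tendsto_nhdsWithin_iff.2 ⟨?_, ?_⟩
      · have : Continuous fun z : ℝ => z - s := by fun_prop
        have := this.tendsto s
        rw [sub_self] at this
        exact this.mono_left nhdsWithin_le_nhds
      · filter_upwards [self_mem_nhdsWithin] with z hz
        exact sub_pos.2 (Set.mem_Ioi.1 hz)
    refine Eventually.frequently ?_
    filter_upwards [hshift.eventually hev, self_mem_nhdsWithin] with z hz hsz
    refine lt_of_le_of_lt ?_ hz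
    have hpos : 0 < z - s := sub_pos.2 hsz
    have e1 := hF s (z - s) hs hpos.le
    have e2 := hp.sum_le hs hpos.le F x y
    rw [add_sub_cancel] at e1 e2
    have e3 : ∑ u ∈ F, (P s x u * ((P (z - s) u y - if u = y then 1 else 0) / (z - s))
          - p s x u * ((p (z - s) u y - if u = y then 1 else 0) / (z - s)))
        = ((∑ u ∈ F, P s x u * P (z - s) u y - ∑ u ∈ F, p s x u * p (z - s) u y)
          - (P s x y - p s x y)) / (z - s) := by
      have : P s x y - p s x y = ∑ u ∈ F, (P s x u - p s x u) * (if u = y then 1 else 0) := by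
        simp [hy]
      rw [this, ← Finset.sum_sub_distrib, ← Finset.sum_sub_distrib, Finset.sum_div]
      refine Finset.sum_congr rfl fun u _ => ?_
      ring
    rw [e3, slope_def_field]
    refine div_le_div_of_nonneg_right ?_ hpos.le
    linarith
  -- `ε (1 + t)` is a strict barrier: it starts above `0`, and where `P - p` meets it the slope of
  -- `P - p` is at most `0 < ε`, as `r(y, y) ≤ 0`.
  have bound : ∀ ε : ℝ, 0 < ε → P T x y - p T x y ≤ ε * (1 + T) := by
    intro ε hε
    refine image_le_of_liminf_slope_right_lt_deriv_boundary (f := fun t => P t x y - p t x y)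
      (f' := fun s => r y y * (P s x y - p s x y)) (a := 0) (b := T)
      (B := fun t => ε * (1 + t)) (B' := fun _ => ε) ?_ (fun s hs c hc => key s hs.1 c hc)
      ?_ ?_ ?_ ⟨hT, le_rfl⟩
    · exact ((hPr.continuousOn hP x y).sub (hpr.continuousOn hp x y)).mono fun t ht => ht.1
    · have : P 0 x y = p 0 x y := by
        by_cases hxy : x = y
        · rw [hxy, hP.zero_self, hp.zero_self]
        · rw [hP.zero_ne x y hxy, hp.zero_ne x y hxy]
      simp [this, hε.le]
    · intro t
      simpa using ((hasDerivAt_id t).const_add 1).const_mul ε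
    · intro s hs heq
      have : 0 ≤ ε * (1 + s) := mul_nonneg hε.le (by linarith [hs.1])
      rw [show P s x y - p s x y = _ from heq]
      exact lt_of_le_of_lt (mul_nonpos_of_nonpos_of_nonneg (hpr.self_nonpos hp y) this) hε
  have hlim : Tendsto (fun ε : ℝ => ε * (1 + T)) (𝓝[>] 0) (𝓝 0) := by
    have : Continuous fun ε : ℝ => ε * (1 + T) := by fun_prop
    have := this.tendsto 0
    rw [zero_mul] at this
    exact this.mono_left nhdsWithin_le_nhds
  have := ge_of_tendsto hlim (by filter_upwards [self_mem_nhdsWithin] with ε hε using bound ε hε)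
  linarith

/-- A transition function whose rows sum to `1` is determined by its rates if the forward equation
only runs over finitely many intermediate states, which are ordered by a rank. -/
theorem IsTransitionSemigroup.eq_of_hasTransitionRates (hP : IsTransitionSemigroup P)
    (hPr : HasTransitionRates P r) (hp : IsTransitionFunction p) (hpr : HasTransitionRates p r)
    (x : S) (F : S → Finset S) (hF : ∀ y s h, 0 ≤ s → 0 ≤ h →
      P (s + h) x y = ∑ u ∈ F y, P s x u * P h u y)
    (hmem : ∀ y, y ∉ F y → ∀ t, 0 ≤ t → P t x y = 0)
    (rank : S → ℕ) (hrank : ∀ y, ∀ u ∈ F y, u ≠ y → r u y ≠ 0 → rank u < rank y)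
    {t : ℝ} (ht : 0 ≤ t) (y : S) : p t x y = P t x y := by
  have hle : ∀ n y, rank y = n → ∀ t, 0 ≤ t → P t x y ≤ p t x y := by
    intro n
    induction n using Nat.strong_induction_on with
    | _ n ih =>
      intro y hy
      by_cases hyF : y ∈ F y
      · refine hP.le_of_forward hPr hp hpr (F y) hyF (hF y) fun u hu huy hr => ?_
        exact ih (rank u) (hy ▸ hrank y u hu huy hr) u rfl
      · intro t ht
        rw [hmem y hyF t ht]
        exact hp.nonneg t ht x y
  by_contra hne
  have hlt : P t x y < p t x y := lt_of_le_of_ne (hle _ y rfl t ht) (Ne.symm hne)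
  have := Summable.tsum_lt_tsum (fun u => hle _ u rfl t ht) hlt (hP.summable t ht x)
    (hp.summable t ht x)
  rw [(hP.hasSum_one t ht x).tsum_eq] at this
  exact absurd (hp.tsum_le_one t ht x) (not_le.2 this)

end Uniqueness

/-! ### Wirtinger derivatives -/

section Derivations

open ComplexConjugate

variable {V : Type*} [NormedAddCommGroup V] [InnerProductSpace ℂ V]

namespace RealPoly

@[simp] theorem one_apply (z : V) : (1 : RealPoly V) z = 1 := rfl

@[simp] theorem algebraMap_apply (c : ℂ) (z : V) : algebraMap ℂ (RealPoly V) c z = c := rfl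

@[simp] theorem neg_apply (f : RealPoly V) (z : V) : (-f) z = -f z := rfl

@[simp] theorem sub_apply (f g : RealPoly V) (z : V) : (f - g) z = f z - g z := rfl

@[simp] theorem sum_apply {ι : Type*} (s : Finset ι) (f : ι → RealPoly V) (z : V) :
    (∑ i ∈ s, f i) z = ∑ i ∈ s, f i z := by
  classical
  induction s using Finset.induction_on with
  | empty => simp
  | insert i s hi ih => simp [Finset.sum_insert hi, ih]

/-- A real-linear functional as a polynomial function. -/
def linear (φ : V →L[ℝ] ℂ) : RealPoly V := mk φ (Algebra.subset_adjoin ⟨φ, rfl⟩)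

@[simp] theorem linear_apply (φ : V →L[ℝ] ℂ) (z : V) : linear φ z = φ z := rfl

/-- Constants and real-linear functionals generate the polynomial functions. -/
@[elab_as_elim]
theorem induction {C : RealPoly V → Prop} (const : ∀ c : ℂ, C (algebraMap ℂ _ c))
    (lin : ∀ φ, C (linear φ)) (add : ∀ f g, C f → C g → C (f + g))
    (mul : ∀ f g, C f → C g → C (f * g)) (f : RealPoly V) : C f := by
  have key : ∀ g (hg : g ∈ realPolyAlg V), C (mk g hg) := by
    intro g hg
    unfold realPolyAlg at hg
    induction hg using Algebra.adjoin_induction with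
    | mem x hx => obtain ⟨φ, rfl⟩ := hx; exact lin φ
    | algebraMap r => exact const r
    | add x y hx hy h1 h2 => exact add _ _ h1 h2
    | mul x y hx hy h1 h2 => exact mul _ _ h1 h2
  exact key f f.mem

theorem differentiable (f : RealPoly V) : Differentiable ℝ (fun z => f z) := by
  induction f using RealPoly.induction with
  | const c => exact differentiable_const c
  | lin φ => exact φ.differentiable
  | add f g hf hg => exact hf.add hg
  | mul f g hf hg => exact hf.mul hg

theorem fderiv_mem (f : RealPoly V) (a : V) :
    (fun z => fderiv ℝ (fun z => f z) z a) ∈ realPolyAlg V := by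
  induction f using RealPoly.induction with
  | const c =>
    convert (realPolyAlg V).zero_mem using 1
    ext z
    change fderiv ℝ (fun _ => c) z a = 0
    simp
  | lin φ =>
    convert (realPolyAlg V).algebraMap_mem (φ a) using 1
    ext z
    change fderiv ℝ φ z a = _
    simp
  | add f g hf hg =>
    convert (realPolyAlg V).add_mem hf hg using 1
    ext z
    change fderiv ℝ (fun z => f z + g z) z a = _
    rw [fderiv_fun_add (f.differentiable z) (g.differentiable z)]
    rfl
  | mul f g hf hg =>
    convert (realPolyAlg V).add_mem ((realPolyAlg V).mul_mem f.mem hg)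
      ((realPolyAlg V).mul_mem g.mem hf) using 1
    ext z
    change fderiv ℝ (fun z => f z * g z) z a = _
    rw [fderiv_fun_mul (f.differentiable z) (g.differentiable z)]
    rfl

end RealPoly

open RealPoly

/-- The derivative in the real direction `a`. -/
def dirDeriv (a : V) : Derivation ℂ (RealPoly V) (RealPoly V) :=
  Derivation.mk'
    { toFun := fun f => mk _ (f.fderiv_mem a)
      map_add' := fun f g => by
        ext z
        change fderiv ℝ (fun z => f z + g z) z a = _
        rw [fderiv_fun_add (f.differentiable z) (g.differentiable z)]
        rfl
      map_smul' := fun c f => by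
        ext z
        change fderiv ℝ (fun z => c * f z) z a = c * fderiv ℝ (fun z => f z) z a
        rw [fderiv_const_mul (f.differentiable z)]
        rfl }
    fun f g => by
      ext z
      change fderiv ℝ (fun z => f z * g z) z a = _
      rw [fderiv_fun_mul (f.differentiable z) (g.differentiable z)]
      rfl

theorem dirDeriv_apply (a : V) (f : RealPoly V) (z : V) :
    dirDeriv a f z = fderiv ℝ (fun z => f z) z a := rfl

theorem dirDeriv_linear (a : V) (φ : V →L[ℝ] ℂ) :
    dirDeriv a (linear φ) = algebraMap ℂ _ (φ a) := by
  ext z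
  change fderiv ℝ φ z a = _
  simp

theorem dirDeriv_add (a b : V) (f : RealPoly V) :
    dirDeriv (a + b) f = dirDeriv a f + dirDeriv b f := by
  ext z
  simp [dirDeriv_apply]

theorem dirDeriv_real_smul (t : ℝ) (a : V) (f : RealPoly V) :
    dirDeriv (t • a) f = (t : ℂ) • dirDeriv a f := by
  ext z
  rw [RealPoly.smul_apply, dirDeriv_apply, dirDeriv_apply, map_smul, Complex.real_smul]

/-- Two derivations of `ℂ[V_ℝ]` agree if they agree on real-linear functionals. -/
theorem derivation_ext {D₁ D₂ : Derivation ℂ (RealPoly V) (RealPoly V)}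
    (h : ∀ φ, D₁ (linear φ) = D₂ (linear φ)) (f : RealPoly V) : D₁ f = D₂ f := by
  induction f using RealPoly.induction with
  | const c => simp
  | lin φ => exact h φ
  | add f g hf hg => rw [map_add, map_add, hf, hg]
  | mul f g hf hg => rw [Derivation.leibniz, Derivation.leibniz, hf, hg]

/-- Constant coefficient derivations commute. -/
theorem derivation_comm {D₁ D₂ : Derivation ℂ (RealPoly V) (RealPoly V)}
    (h₁ : ∀ φ, ∃ c, D₁ (linear φ) = algebraMap ℂ _ c)
    (h₂ : ∀ φ, ∃ c, D₂ (linear φ) = algebraMap ℂ _ c) (f : RealPoly V) :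
    D₁ (D₂ f) = D₂ (D₁ f) := by
  have h : (⁅D₁, D₂⁆ : Derivation ℂ (RealPoly V) (RealPoly V)) f
      = (0 : Derivation ℂ (RealPoly V) (RealPoly V)) f := by
    refine derivation_ext (fun φ => ?_) f
    obtain ⟨c, hc⟩ := h₁ φ
    obtain ⟨d, hd⟩ := h₂ φ
    simp [Derivation.commutator_apply, hc, hd]
  rw [Derivation.commutator_apply, Derivation.zero_apply] at h
  exact sub_eq_zero.1 h

/-- The Wirtinger derivative `∂_a`, which differentiates the holomorphic part. -/
def del (a : V) : Derivation ℂ (RealPoly V) (RealPoly V) :=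
  (1 / 2 : ℂ) • (dirDeriv a - Complex.I • dirDeriv (Complex.I • a))

/-- The Wirtinger derivative `∂̄_a`, which differentiates the antiholomorphic part. -/
def delBar (a : V) : Derivation ℂ (RealPoly V) (RealPoly V) :=
  (1 / 2 : ℂ) • (dirDeriv a + Complex.I • dirDeriv (Complex.I • a))

theorem del_apply (a : V) (f : RealPoly V) :
    del a f = (1 / 2 : ℂ) • (dirDeriv a f - Complex.I • dirDeriv (Complex.I • a) f) := rfl

theorem delBar_apply (a : V) (f : RealPoly V) :
    delBar a f = (1 / 2 : ℂ) • (dirDeriv a f + Complex.I • dirDeriv (Complex.I • a) f) := rfl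

theorem del_linear (a : V) (φ : V →L[ℝ] ℂ) : ∃ c, del a (linear φ) = algebraMap ℂ _ c :=
  ⟨1 / 2 * (φ a - Complex.I * φ (Complex.I • a)), by
    ext z; simp [del_apply, dirDeriv_linear]⟩

theorem delBar_linear (a : V) (φ : V →L[ℝ] ℂ) : ∃ c, delBar a (linear φ) = algebraMap ℂ _ c :=
  ⟨1 / 2 * (φ a + Complex.I * φ (Complex.I • a)), by
    ext z; simp [delBar_apply, dirDeriv_linear, mul_add]⟩

theorem del_comm_delBar (a b : V) (f : RealPoly V) :
    del a (delBar b f) = delBar b (del a f) :=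
  derivation_comm (del_linear a) (delBar_linear b) f

theorem del_comm (a b : V) (f : RealPoly V) : del a (del b f) = del b (del a f) :=
  derivation_comm (del_linear a) (del_linear b) f

theorem delBar_comm (a b : V) (f : RealPoly V) :
    delBar a (delBar b f) = delBar b (delBar a f) :=
  derivation_comm (delBar_linear a) (delBar_linear b) f

namespace RealPoly

@[simp] theorem conj_conj (f : RealPoly V) : f.conj.conj = f := by ext z; simp

@[simp] theorem conj_add (f g : RealPoly V) : (f + g).conj = f.conj + g.conj := by ext z; simp

@[simp] theorem conj_mul (f g : RealPoly V) : (f * g).conj = f.conj * g.conj := by ext z; simp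

@[simp] theorem conj_smul (c : ℂ) (f : RealPoly V) : (c • f).conj = conj c • f.conj := by
  ext z; simp

@[simp] theorem conj_one : (1 : RealPoly V).conj = 1 := by ext z; simp

@[simp] theorem conj_zero : (0 : RealPoly V).conj = 0 := by ext z; simp

@[simp] theorem conj_sum {ι : Type*} (s : Finset ι) (f : ι → RealPoly V) :
    (∑ i ∈ s, f i).conj = ∑ i ∈ s, (f i).conj := by ext z; simp

end RealPoly

theorem dirDeriv_conj (a : V) (f : RealPoly V) : dirDeriv a f.conj = (dirDeriv a f).conj := by
  ext z
  have h :=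
    ((Complex.conjCLE : ℂ →L[ℝ] ℂ).hasFDerivAt.comp z (f.differentiable z).hasFDerivAt).fderiv
  change fderiv ℝ ((Complex.conjCLE : ℂ →L[ℝ] ℂ) ∘ fun z => f z) z a = _
  rw [h]
  rfl

theorem del_conj (a : V) (f : RealPoly V) : del a f.conj = (delBar a f).conj := by
  ext z
  simp only [del_apply, delBar_apply, dirDeriv_conj, RealPoly.conj_apply, RealPoly.smul_apply,
    RealPoly.add_apply, RealPoly.sub_apply, map_add, map_mul, Complex.conj_I, map_div₀, map_one,
    Complex.conj_ofNat]
  ring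

theorem delBar_conj (a : V) (f : RealPoly V) : delBar a f.conj = (del a f).conj := by
  rw [← RealPoly.conj_conj (delBar a f.conj), ← del_conj, RealPoly.conj_conj]

theorem del_add_dir (a b : V) (f : RealPoly V) : del (a + b) f = del a f + del b f := by
  ext z
  simp only [del_apply, smul_add, dirDeriv_add, RealPoly.smul_apply, RealPoly.sub_apply,
    RealPoly.add_apply]
  ring

theorem del_smul_dir (c : ℂ) (a : V) (f : RealPoly V) : del (c • a) f = c • del a f := by
  have h : c • a = c.re • a + c.im • (Complex.I • a) := by
    conv_lhs => rw [← Complex.re_add_im c]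
    rw [add_smul, mul_smul]
    simp [Complex.coe_smul]
  have h' : Complex.I • c • a = c.re • (Complex.I • a) + (-c.im) • a := by
    rw [h, smul_add, smul_comm Complex.I c.re, smul_comm Complex.I c.im, smul_smul Complex.I,
      Complex.I_mul_I]
    simp
  ext z
  simp only [del_apply, h', RealPoly.smul_apply, RealPoly.sub_apply]
  rw [h]
  simp only [dirDeriv_add, dirDeriv_real_smul, RealPoly.smul_apply,
    RealPoly.add_apply]
  conv_rhs => rw [← Complex.re_add_im c]
  push_cast
  ring_nf
  simp only [Complex.I_sq]
  ring

/-- The holomorphic linear function `z ↦ ⟨a, z⟩`. -/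
def coord (a : V) : RealPoly V := linear ((innerSL ℂ a).restrictScalars ℝ)

@[simp] theorem coord_apply (a z : V) : coord a z = inner ℂ a z := rfl

@[simp] theorem del_coord (a b : V) : del b (coord a) = algebraMap ℂ _ (inner ℂ a b) := by
  ext z
  simp only [coord, del_apply, dirDeriv_linear]
  simp
  linear_combination (-(1 / 2) * inner ℂ a b) * Complex.I_mul_I

@[simp] theorem delBar_coord (a b : V) : delBar b (coord a) = 0 := by
  ext z
  simp only [coord, delBar_apply, dirDeriv_linear]
  simp
  linear_combination (1 / 2 * inner ℂ a b) * Complex.I_mul_I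

end Derivations

/-! ### Integration by parts against the Gaussian -/

section Stein

open RealPoly ComplexConjugate

variable {V : Type*} [NormedAddCommGroup V] [InnerProductSpace ℂ V] [FiniteDimensional ℂ V]
  [MeasurableSpace V] [BorelSpace V]

theorem fock_add_left (f g h : RealPoly V) : fock (f + g) h = fock f h + fock g h :=
  inner_add_right (𝕜 := ℂ) h f g

theorem fock_add_right (f g h : RealPoly V) : fock f (g + h) = fock f g + fock f h :=
  inner_add_left (𝕜 := ℂ) g h f

theorem fock_sub_left (f g h : RealPoly V) : fock (f - g) h = fock f h - fock g h :=
  inner_sub_right (𝕜 := ℂ) h f g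

theorem fock_smul_left (c : ℂ) (f g : RealPoly V) : fock (c • f) g = c * fock f g :=
  inner_smul_right (𝕜 := ℂ) g f c

theorem fock_smul_right (c : ℂ) (f g : RealPoly V) : fock f (c • g) = conj c * fock f g :=
  inner_smul_left (𝕜 := ℂ) g f c

@[simp] theorem fock_zero_left (f : RealPoly V) : fock 0 f = 0 := inner_zero_right (𝕜 := ℂ) f

@[simp] theorem fock_zero_right (f : RealPoly V) : fock f 0 = 0 := inner_zero_left (𝕜 := ℂ) f

theorem fock_sum_left {ι : Type*} (s : Finset ι) (f : ι → RealPoly V) (g : RealPoly V) :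
    fock (∑ i ∈ s, f i) g = ∑ i ∈ s, fock (f i) g := inner_sum (𝕜 := ℂ) s f g

theorem fock_sum_right {ι : Type*} (s : Finset ι) (f : RealPoly V) (g : ι → RealPoly V) :
    fock f (∑ i ∈ s, g i) = ∑ i ∈ s, fock f (g i) := sum_inner (𝕜 := ℂ) s g f

theorem fock_conj_symm (f g : RealPoly V) : conj (fock f g) = fock g f :=
  inner_conj_symm (𝕜 := ℂ) f g

theorem eq_zero_of_fock_self {f : RealPoly V} (h : fock f f = 0) : f = 0 :=
  inner_self_eq_zero (𝕜 := ℂ).1 h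

theorem fock_mul_left (f g h : RealPoly V) : fock (f * g) h = fock f (g.conj * h) := by
  simp only [fock, RealPoly.mul_apply, RealPoly.conj_apply, map_mul, Complex.conj_conj, mul_assoc]

theorem fock_mul_conj (f g : RealPoly V) : fock (f * g.conj) 1 = fock f g := by
  rw [fock_mul_left]
  simp

theorem fock_one_one : fock (1 : RealPoly V) 1 = 1 := by
  rw [fock_self]
  have h : ∫ z : V, Real.exp (-‖z‖ ^ 2) ∂(lebesgue V) = Real.pi ^ finrank ℂ V := by
    let : InnerProductSpace ℝ V := InnerProductSpace.rclikeToReal ℂ V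
    have := GaussianFourier.integral_rexp_neg_mul_sq_norm (V := V) (b := 1) one_pos
    have h2 : finrank ℝ V = 2 * finrank ℂ V := finrank_real_of_complex V
    rw [h2] at this
    simp only [neg_mul, one_mul, div_one, Nat.cast_mul, Nat.cast_ofNat] at this
    rw [mul_div_cancel_left₀ _ (two_ne_zero), Real.rpow_natCast] at this
    exact this
  simp only [RealPoly.one_apply, norm_one, one_pow, one_mul, h]
  rw [← mul_pow, inv_mul_cancel₀ Real.pi_ne_zero]
  simp

/-- Integration by parts in the real direction `a`. -/
theorem integral_dirDeriv (a : V) (f : RealPoly V) :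
    fock (dirDeriv a f) 1 = fock (coord a * f) 1 + fock ((coord a).conj * f) 1 := by
  have hg : ∀ z : V, HasFDerivAt (fun z : V => (Real.exp (-‖z‖ ^ 2) : ℂ))
      (fderiv ℝ (fun z : V => (Real.exp (-‖z‖ ^ 2) : ℂ)) z) z ∧
      fderiv ℝ (fun z : V => (Real.exp (-‖z‖ ^ 2) : ℂ)) z a
        = -((inner ℂ a z + conj (inner ℂ a z)) * (Real.exp (-‖z‖ ^ 2) : ℂ)) := by
    intro z
    let : InnerProductSpace ℝ V := InnerProductSpace.rclikeToReal ℂ V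
    have h1 : HasFDerivAt (fun z : V => ‖z‖ ^ 2) (2 • innerSL ℝ z) z :=
      (hasStrictFDerivAt_norm_sq z).hasFDerivAt
    have h2 := Complex.ofRealCLM.hasFDerivAt.comp z h1.neg.exp
    refine ⟨h2.differentiableAt.hasFDerivAt, ?_⟩
    rw [show fderiv ℝ (fun z : V => (Real.exp (-‖z‖ ^ 2) : ℂ)) z = _ from h2.fderiv]
    have h3 : inner ℝ z a = (inner ℂ a z).re := by
      rw [← inner_conj_symm]; rfl
    rw [Complex.add_conj]
    simp [h3]
    ring
  have h := integral_mul_fderiv_eq_neg_fderiv_mul_of_integrable (μ := lebesgue V)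
    (f := fun z => f z) (g := fun z : V => (Real.exp (-‖z‖ ^ 2) : ℂ)) (v := a)
    (integrable_gauss (dirDeriv a f)) ?_ (integrable_gauss f) (fun z _ => f.differentiable z)
    (fun z _ => (hg z).1.differentiableAt)
  · rw [← fock_add_left, ← add_mul]
    unfold fock
    congr 1
    simp only [RealPoly.one_apply, map_one, mul_one]
    rw [eq_neg_iff_add_eq_zero, add_comm, ← eq_neg_iff_add_eq_zero] at h
    refine h.trans ?_
    rw [← integral_neg]
    congr 1
    ext z
    rw [(hg z).2]
    simp only [RealPoly.mul_apply, RealPoly.add_apply, RealPoly.conj_apply, coord_apply]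
    ring
  · refine (integrable_gauss (-((coord a + (coord a).conj) * f))).congr
      (Filter.Eventually.of_forall fun z => ?_)
    simp only
    rw [(hg z).2]
    simp only [RealPoly.neg_apply, RealPoly.mul_apply, RealPoly.add_apply, RealPoly.conj_apply,
      coord_apply]
    ring

theorem fock_delBar_one (a : V) (f : RealPoly V) : fock (delBar a f) 1 = fock (coord a * f) 1 := by
  have h1 : coord (Complex.I • a) = (-Complex.I) • coord a := by
    ext z; simp [mul_comm]
  rw [delBar_apply, fock_smul_left, fock_add_left, fock_smul_left, integral_dirDeriv,
    integral_dirDeriv, h1, conj_smul, smul_mul_assoc, smul_mul_assoc, fock_smul_left,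
    fock_smul_left]
  simp only [map_neg, Complex.conj_I]
  linear_combination (-1 / 2 * fock (coord a * f) 1 + 1 / 2 * fock ((coord a).conj * f) 1) *
    Complex.I_mul_I

theorem fock_del_one (a : V) (f : RealPoly V) :
    fock (del a f) 1 = fock ((coord a).conj * f) 1 := by
  have h1 : coord (Complex.I • a) = (-Complex.I) • coord a := by
    ext z; simp [mul_comm]
  rw [del_apply, fock_smul_left, fock_sub_left, fock_smul_left, integral_dirDeriv,
    integral_dirDeriv, h1, conj_smul, smul_mul_assoc, smul_mul_assoc, fock_smul_left,
    fock_smul_left]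
  simp only [map_neg, Complex.conj_I]
  linear_combination (1 / 2 * fock (coord a * f) 1 - 1 / 2 * fock ((coord a).conj * f) 1) *
    Complex.I_mul_I

/-- The adjoint of `∂_a` in the Gaussian inner product is `z_a - ∂̄_a`. -/
theorem fock_coord_mul_sub_delBar (a : V) (f g : RealPoly V) :
    fock (coord a * f - delBar a f) g = fock f (del a g) := by
  have h := fock_delBar_one a (f * g.conj)
  rw [Derivation.leibniz, smul_eq_mul, smul_eq_mul, delBar_conj, fock_add_left, fock_mul_conj,
    mul_comm g.conj, fock_mul_conj, ← mul_assoc, fock_mul_conj] at h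
  rw [fock_sub_left, ← h]
  ring

/-- The adjoint of `∂̄_a` in the Gaussian inner product is `z̄_a - ∂_a`. -/
theorem fock_conj_coord_mul_sub_del (a : V) (f g : RealPoly V) :
    fock ((coord a).conj * f - del a f) g = fock f (delBar a g) := by
  have h := fock_del_one a (f * g.conj)
  rw [Derivation.leibniz, smul_eq_mul, smul_eq_mul, del_conj, fock_add_left, fock_mul_conj,
    mul_comm g.conj, fock_mul_conj, ← mul_assoc, fock_mul_conj] at h
  rw [fock_sub_left, ← h]
  ring

end Stein

/-! ### The Laplacian and its heat operator -/

section Laplace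

open RealPoly ComplexConjugate

variable {V : Type*} [NormedAddCommGroup V] [InnerProductSpace ℂ V]

/-- Polynomial functions of (real) degree less than `k`, as the functions killed by any `k`
directional derivatives. -/
def degreeLT : ℕ → Submodule ℂ (RealPoly V)
  | 0 => ⊥
  | k + 1 => ⨅ a : V, (degreeLT k).comap (dirDeriv a : RealPoly V →ₗ[ℂ] RealPoly V)

theorem mem_degreeLT_succ {k : ℕ} {f : RealPoly V} :
    f ∈ degreeLT (k + 1) ↔ ∀ a, dirDeriv a f ∈ degreeLT k := by
  simp [degreeLT]

theorem degreeLT_mono : Monotone (degreeLT (V := V)) := by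
  refine monotone_nat_of_le_succ fun k => ?_
  induction k with
  | zero => exact bot_le
  | succ k ih =>
    intro f hf
    rw [mem_degreeLT_succ] at hf ⊢
    exact fun a => ih (hf a)

theorem mul_mem_degreeLT {f g : RealPoly V} : ∀ {k l : ℕ}, f ∈ degreeLT k → g ∈ degreeLT l →
    f * g ∈ degreeLT (k + l) := by
  suffices ∀ n k l : ℕ, k + l = n → ∀ f g : RealPoly V, f ∈ degreeLT k → g ∈ degreeLT l →
      f * g ∈ degreeLT n from fun {k l} hf hg => this _ k l rfl f g hf hg
  intro n
  induction n with
  | zero =>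
    intro k l h f g hf hg
    obtain ⟨rfl, rfl⟩ : k = 0 ∧ l = 0 := by omega
    rw [(Submodule.mem_bot ℂ).1 hf, zero_mul]
    exact zero_mem _
  | succ n ih =>
    rintro (_ | k) (_ | l) h f g hf hg
    · omega
    · rw [(Submodule.mem_bot ℂ).1 hf, zero_mul]
      exact zero_mem _
    · rw [(Submodule.mem_bot ℂ).1 hg, mul_zero]
      exact zero_mem _
    · rw [mem_degreeLT_succ]
      intro a
      rw [Derivation.leibniz, smul_eq_mul, smul_eq_mul, mul_comm g]
      exact add_mem (ih (k + 1) l (by omega) _ _ hf (mem_degreeLT_succ.1 hg a))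
        (ih k (l + 1) (by omega) _ _ (mem_degreeLT_succ.1 hf a) hg)

theorem exists_mem_degreeLT (f : RealPoly V) : ∃ k, f ∈ degreeLT k := by
  have hconst : ∀ c : ℂ, algebraMap ℂ (RealPoly V) c ∈ degreeLT 1 := fun c => by
    rw [mem_degreeLT_succ]
    intro a
    rw [Derivation.map_algebraMap]
    exact zero_mem _
  induction f using RealPoly.induction with
  | const c => exact ⟨1, hconst c⟩
  | lin φ =>
    refine ⟨2, mem_degreeLT_succ.2 fun a => ?_⟩
    rw [dirDeriv_linear]
    exact hconst _
  | add f g hf hg =>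
    obtain ⟨k, hk⟩ := hf
    obtain ⟨l, hl⟩ := hg
    exact ⟨max k l, add_mem (degreeLT_mono (le_max_left _ _) hk)
      (degreeLT_mono (le_max_right _ _) hl)⟩
  | mul f g hf hg =>
    obtain ⟨k, hk⟩ := hf
    obtain ⟨l, hl⟩ := hg
    exact ⟨k + l, mul_mem_degreeLT hk hl⟩

theorem del_mem_degreeLT {k : ℕ} {f : RealPoly V} (hf : f ∈ degreeLT (k + 1)) (a : V) :
    del a f ∈ degreeLT k := by
  rw [mem_degreeLT_succ] at hf
  exact Submodule.smul_mem _ _ (sub_mem (hf a) (Submodule.smul_mem _ _ (hf _)))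

theorem delBar_mem_degreeLT {k : ℕ} {f : RealPoly V} (hf : f ∈ degreeLT (k + 1)) (a : V) :
    delBar a f ∈ degreeLT k := by
  rw [mem_degreeLT_succ] at hf
  exact Submodule.smul_mem _ _ (add_mem (hf a) (Submodule.smul_mem _ _ (hf _)))

theorem sum_inner_del {ι : Type*} [Fintype ι] (b : OrthonormalBasis ι ℂ V) (a : V)
    (f : RealPoly V) : ∑ i, inner ℂ (b i) a • del (b i) f = del a f := by
  let L : V →ₗ[ℂ] RealPoly V :=
    { toFun := fun a => del a f
      map_add' := fun a b => del_add_dir a b f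
      map_smul' := fun c a => del_smul_dir c a f }
  change _ = L a
  conv_rhs => rw [← b.sum_repr' a, map_sum]
  simp only [map_smul]
  rfl

theorem sum_inner_delBar {ι : Type*} [Fintype ι] (b : OrthonormalBasis ι ℂ V) (a : V)
    (f : RealPoly V) : ∑ i, inner ℂ a (b i) • delBar (b i) f = delBar a f := by
  have := congrArg RealPoly.conj (sum_inner_del b a f.conj)
  simpa [del_conj] using this

variable [FiniteDimensional ℂ V]

/-- The Laplacian `∑ ∂_i ∂̄_i` (a quarter of the Euclidean one). -/
def laplace : Module.End ℂ (RealPoly V) :=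
  ∑ i, (del (stdOrthonormalBasis ℂ V i) : RealPoly V →ₗ[ℂ] RealPoly V) ∘ₗ
    (delBar (stdOrthonormalBasis ℂ V i) : RealPoly V →ₗ[ℂ] RealPoly V)

theorem laplace_apply (f : RealPoly V) : laplace f =
    ∑ i, del (stdOrthonormalBasis ℂ V i) (delBar (stdOrthonormalBasis ℂ V i) f) := by
  simp [laplace]

theorem laplace_eq {ι : Type*} [Fintype ι] (b : OrthonormalBasis ι ℂ V) (f : RealPoly V) :
    laplace f = ∑ i, del (b i) (delBar (b i) f) := by
  rw [laplace_apply]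
  simp_rw [← sum_inner_del b (stdOrthonormalBasis ℂ V _)]
  rw [Finset.sum_comm]
  refine Finset.sum_congr rfl fun i _ => ?_
  rw [← sum_inner_delBar (stdOrthonormalBasis ℂ V) (b i) f, map_sum]
  simp only [Derivation.map_smul]

theorem laplace_del (a : V) (f : RealPoly V) : laplace (del a f) = del a (laplace f) := by
  simp only [laplace_apply, map_sum, del_comm a, ← del_comm_delBar]

theorem laplace_delBar (a : V) (f : RealPoly V) :
    laplace (delBar a f) = delBar a (laplace f) := by
  simp only [laplace_apply, map_sum, delBar_comm _ a, del_comm_delBar]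

theorem laplace_conj (f : RealPoly V) : laplace f.conj = (laplace f).conj := by
  simp only [laplace_apply, conj_sum, delBar_conj, del_conj, ← del_comm_delBar]

theorem laplace_coord_mul (a : V) (f : RealPoly V) :
    laplace (coord a * f) = coord a * laplace f + delBar a f := by
  rw [laplace_apply, laplace_apply, Finset.mul_sum,
    ← sum_inner_delBar (stdOrthonormalBasis ℂ V) a f, ← Finset.sum_add_distrib]
  refine Finset.sum_congr rfl fun i _ => ?_
  simp only [Derivation.leibniz, delBar_coord, del_coord, smul_eq_mul, mul_zero, add_zero]
  rw [Algebra.smul_def, mul_comm (delBar _ _)]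

theorem laplace_pow_coord_mul (a : V) (f : RealPoly V) (k : ℕ) :
    (laplace ^ (k + 1)) (coord a * f)
      = coord a * (laplace ^ (k + 1)) f + ((k : ℂ) + 1) • delBar a ((laplace ^ k) f) := by
  induction k with
  | zero => simp [laplace_coord_mul]
  | succ k ih =>
    rw [pow_succ', Module.End.mul_apply, ih, map_add, map_smul, laplace_coord_mul, laplace_delBar,
      ← Module.End.mul_apply, ← pow_succ', ← Module.End.mul_apply, ← pow_succ']
    push_cast
    module

theorem laplace_mem_degreeLT {k : ℕ} {f : RealPoly V} (hf : f ∈ degreeLT (k + 1)) :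
    laplace f ∈ degreeLT k := by
  rw [laplace_apply]
  exact sum_mem fun i _ => del_mem_degreeLT (degreeLT_mono (Nat.le_succ _)
    (delBar_mem_degreeLT hf _)) _

/-- The Laplacian is locally nilpotent. -/
theorem exists_laplace_pow_eq_zero (f : RealPoly V) : ∃ N, ∀ k, N ≤ k → (laplace ^ k) f = 0 := by
  have h : ∀ N (f : RealPoly V), f ∈ degreeLT N → (laplace ^ N) f = 0 := by
    intro N
    induction N with
    | zero => intro f hf; simpa using (Submodule.mem_bot ℂ).1 hf
    | succ N ih =>
      intro f hf
      rw [pow_succ, Module.End.mul_apply]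
      exact ih _ (laplace_mem_degreeLT hf)
  obtain ⟨N, hN⟩ := exists_mem_degreeLT f
  exact ⟨N, fun k hk => h k f (degreeLT_mono hk hN)⟩

theorem finite_support_heat (f : RealPoly V) :
    (Function.support fun k : ℕ => ((-1) ^ k / k.factorial : ℂ) • (laplace ^ k) f).Finite := by
  obtain ⟨N, hN⟩ := exists_laplace_pow_eq_zero f
  refine (Set.finite_Iio N).subset fun k hk => ?_
  by_contra h
  exact hk (by simp [hN k (not_lt.1 h)])

/-- The backward heat operator `exp(-Δ)`; the sum is finite at each polynomial. -/
def heat : Module.End ℂ (RealPoly V) where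
  toFun f := ∑ᶠ k : ℕ, ((-1) ^ k / k.factorial : ℂ) • (laplace ^ k) f
  map_add' f g := by
    rw [← finsum_add_distrib (finite_support_heat f) (finite_support_heat g)]
    simp
  map_smul' c f := by
    rw [RingHom.id_apply, smul_finsum' _ (finite_support_heat f)]
    simp [smul_comm c]

theorem heat_eq_sum {f : RealPoly V} {N : ℕ} (h : ∀ k, N ≤ k → (laplace ^ k) f = 0) :
    heat f = ∑ k ∈ Finset.range N, ((-1) ^ k / k.factorial : ℂ) • (laplace ^ k) f := by
  refine finsum_eq_sum_of_support_subset _ fun k hk => ?_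
  by_contra h'
  exact hk (by simp [h k (by simpa using h')])

theorem heat_comm {T : Module.End ℂ (RealPoly V)} (hT : ∀ f, laplace (T f) = T (laplace f))
    (f : RealPoly V) : heat (T f) = T (heat f) := by
  have h : ∀ k f, (laplace ^ k) (T f) = T ((laplace ^ k) f) := by
    intro k
    induction k with
    | zero => simp
    | succ k ih => intro f; rw [pow_succ, Module.End.mul_apply, hT, ih, Module.End.mul_apply]
  obtain ⟨N, hN⟩ := exists_laplace_pow_eq_zero f
  rw [heat_eq_sum hN, heat_eq_sum (f := T f) (N := N) fun k hk => by rw [h, hN k hk, map_zero],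
    map_sum]
  simp only [h, map_smul]

theorem heat_del (a : V) (f : RealPoly V) : heat (del a f) = del a (heat f) :=
  heat_comm (T := (del a : RealPoly V →ₗ[ℂ] RealPoly V)) (laplace_del a) f

theorem heat_delBar (a : V) (f : RealPoly V) : heat (delBar a f) = delBar a (heat f) :=
  heat_comm (T := (delBar a : RealPoly V →ₗ[ℂ] RealPoly V)) (laplace_delBar a) f

theorem laplace_pow_conj (k : ℕ) (f : RealPoly V) :
    (laplace ^ k) f.conj = ((laplace ^ k) f).conj := by
  induction k generalizing f with
  | zero => simp
  | succ k ih => rw [pow_succ, Module.End.mul_apply, laplace_conj, ih, Module.End.mul_apply]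

theorem heat_conj (f : RealPoly V) : heat f.conj = (heat f).conj := by
  obtain ⟨N, hN⟩ := exists_laplace_pow_eq_zero f
  rw [heat_eq_sum hN, heat_eq_sum (f := f.conj) (N := N) fun k hk => by
    rw [laplace_pow_conj, hN k hk, conj_zero], conj_sum]
  refine Finset.sum_congr rfl fun k _ => ?_
  rw [laplace_pow_conj, conj_smul]
  simp

theorem heat_coord_mul (a : V) (f : RealPoly V) :
    heat (coord a * f) = coord a * heat f - delBar a (heat f) := by
  obtain ⟨N, hN⟩ := exists_laplace_pow_eq_zero f
  have hN' : ∀ k, N + 1 ≤ k → (laplace ^ k) (coord a * f) = 0 := by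
    rintro (_ | k) hk
    · omega
    · rw [laplace_pow_coord_mul, hN _ (by omega), hN _ (by omega)]
      simp
  rw [heat_eq_sum hN']
  nth_rewrite 1 [heat_eq_sum (f := f) (N := N + 1) fun k hk => hN k (by omega)]
  rw [heat_eq_sum hN, Finset.sum_range_succ', Finset.sum_range_succ', map_sum, mul_add,
    Finset.mul_sum, add_sub_right_comm, ← Finset.sum_sub_distrib]
  congr 1
  · refine Finset.sum_congr rfl fun k _ => ?_
    rw [laplace_pow_coord_mul, smul_add, mul_smul_comm, Derivation.map_smul, smul_smul,
      sub_eq_add_neg, ← neg_smul]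
    congr 2
    rw [Nat.factorial_succ]
    have h1 : (k.factorial : ℂ) ≠ 0 := Nat.cast_ne_zero.2 k.factorial_ne_zero
    have h2 : (k : ℂ) + 1 ≠ 0 := Nat.cast_add_one_ne_zero k
    push_cast
    field_simp
    ring
  · simp

theorem heat_conj_coord_mul (a : V) (f : RealPoly V) :
    heat ((coord a).conj * f) = (coord a).conj * heat f - del a (heat f) := by
  have h : (coord a).conj * f = (coord a * f.conj).conj := by simp
  rw [h, heat_conj, heat_coord_mul, heat_conj, delBar_conj]
  ext z
  simp

theorem heat_of_laplace_eq_zero {f : RealPoly V} (hf : laplace f = 0) : heat f = f := by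
  rw [heat_eq_sum (N := 1)]
  · simp
  · rintro (_ | k) hk
    · omega
    · rw [pow_succ, Module.End.mul_apply, hf, map_zero]

/-- `e^{-Δ}` is injective since `Δ` is locally nilpotent: the top nonvanishing `Δ^N f` is fixed by
`e^{-Δ}`, which commutes with `Δ`. -/
theorem heat_injective {f : RealPoly V} (hf : heat f = 0) : f = 0 := by
  have h : ∀ N, (laplace ^ N) f = 0 → f = 0 := by
    intro N
    induction N with
    | zero => intro h; simpa using h
    | succ N ih =>
      intro h
      refine ih ?_
      have hc : ∀ g : RealPoly V, laplace ((laplace ^ N) g) = (laplace ^ N) (laplace g) := by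
        intro g
        rw [← Module.End.mul_apply, ← Module.End.mul_apply, ← pow_succ, ← pow_succ']
      rw [← heat_of_laplace_eq_zero (f := (laplace ^ N) f)
        (by rwa [← Module.End.mul_apply, ← pow_succ']), heat_comm hc, hf, map_zero]
  obtain ⟨N, hN⟩ := exists_laplace_pow_eq_zero f
  exact h N (hN N le_rfl)

end Laplace

/-! ### Holomorphic polynomials -/

section Holomorphic

open RealPoly ComplexConjugate

variable {V : Type*} [NormedAddCommGroup V] [InnerProductSpace ℂ V]

theorem mul_mem_holPoly {f g : RealPoly V} (hf : f ∈ holPoly (V := V))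
    (hg : g ∈ holPoly (V := V)) : f * g ∈ holPoly (V := V) := (holPolyAlg V).mul_mem hf hg

theorem algebraMap_mem_holPoly (c : ℂ) : algebraMap ℂ (RealPoly V) c ∈ holPoly (V := V) :=
  (holPolyAlg V).algebraMap_mem c

theorem coord_mem_holPoly (a : V) : coord a ∈ holPoly (V := V) :=
  Algebra.subset_adjoin ⟨innerSL ℂ a, rfl⟩

variable [FiniteDimensional ℂ V]

variable (V) in
/-- The homogeneous holomorphic polynomials of degree `k`, as the span of the products of `k`
coordinate functions. -/
def homog (k : ℕ) : Submodule ℂ (RealPoly V) :=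
  Submodule.span ℂ (Set.range fun i => coord (stdOrthonormalBasis ℂ V i)) ^ k

theorem coord_mem_homog_one (i : Fin (finrank ℂ V)) :
    coord (stdOrthonormalBasis ℂ V i) ∈ homog V 1 := by
  rw [homog, pow_one]
  exact Submodule.subset_span ⟨i, rfl⟩

theorem mul_mem_homog {k l : ℕ} {f g : RealPoly V} (hf : f ∈ homog V k) (hg : g ∈ homog V l) :
    f * g ∈ homog V (k + l) := by
  rw [homog, pow_add]
  exact Submodule.mul_mem_mul hf hg

theorem coord_mul_mem_homog (i : Fin (finrank ℂ V)) {k : ℕ} {f : RealPoly V}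
    (hf : f ∈ homog V k) : coord (stdOrthonormalBasis ℂ V i) * f ∈ homog V (k + 1) := by
  rw [add_comm]
  exact mul_mem_homog (coord_mem_homog_one i) hf

theorem mem_homog_zero {f : RealPoly V} : f ∈ homog V 0 ↔ ∃ c : ℂ, algebraMap ℂ _ c = f := by
  rw [homog, pow_zero, Submodule.mem_one]

/-- Induction over `homog V k`, for predicates that do not mention the membership proof. -/
theorem homog_induction_aux {C : ∀ (_ : ℕ) (_ : RealPoly V), Prop} (zero : ∀ k, C k 0)
    (const : ∀ c : ℂ, C 0 (algebraMap ℂ _ c))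
    (add : ∀ k f g, f ∈ homog V k → g ∈ homog V k → C k f → C k g → C k (f + g))
    (coord_mul : ∀ k i f, f ∈ homog V k → C k f →
      C (k + 1) (coord (stdOrthonormalBasis ℂ V i) * f))
    {k : ℕ} {f : RealPoly V} (hf : f ∈ homog V k) : C k f := by
  suffices ∀ c : ℂ, C k (c • f) by simpa using this 1
  refine Submodule.pow_induction_on_left' _ (C := fun k f _ => ∀ c : ℂ, C k (c • f)) ?_ ?_ ?_ hf
  · intro r c
    rw [Algebra.smul_def, ← map_mul]
    exact const _
  · intro x y i hx hy h1 h2 c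
    rw [smul_add]
    exact add i _ _ (Submodule.smul_mem _ _ hx) (Submodule.smul_mem _ _ hy) (h1 c) (h2 c)
  · intro m hm k x hx h c
    have hmem : ∀ m ∈ Submodule.span ℂ (Set.range fun i => coord (stdOrthonormalBasis ℂ V i)),
        m * x ∈ homog V (k + 1) := fun m hm => by
      rw [homog, pow_succ']
      exact Submodule.mul_mem_mul hm hx
    induction hm using Submodule.span_induction generalizing c with
    | mem y hy =>
      obtain ⟨i, rfl⟩ := hy
      rw [← mul_smul_comm]
      exact coord_mul k i _ (Submodule.smul_mem _ _ hx) (h c)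
    | zero => simpa using zero (k + 1)
    | add y z hy hz h1 h2 =>
      rw [add_mul, smul_add]
      exact add _ _ _ (Submodule.smul_mem _ _ (hmem y hy)) (Submodule.smul_mem _ _ (hmem z hz))
        (h1 c) (h2 c)
    | smul d y hy h1 =>
      rw [smul_mul_assoc, smul_smul]
      exact h1 _

@[elab_as_elim]
theorem homog_induction {C : ∀ (k : ℕ) (f : RealPoly V), f ∈ homog V k → Prop}
    (zero : ∀ k, C k 0 (zero_mem _))
    (const : ∀ c : ℂ, C 0 (algebraMap ℂ _ c) (mem_homog_zero.2 ⟨c, rfl⟩))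
    (add : ∀ k f g hf hg, C k f hf → C k g hg → C k (f + g) (add_mem hf hg))
    (coord_mul : ∀ k i f hf, C k f hf →
      C (k + 1) (coord (stdOrthonormalBasis ℂ V i) * f) (coord_mul_mem_homog i hf))
    {k : ℕ} {f : RealPoly V} (hf : f ∈ homog V k) : C k f hf := by
  suffices ∃ h, C k f h from this.2
  exact homog_induction_aux (C := fun k f => ∃ h, C k f h) (fun k => ⟨_, zero k⟩)
    (fun c => ⟨_, const c⟩) (fun k f g hf hg h1 h2 => ⟨_, add k f g hf hg h1.2 h2.2⟩)
    (fun k i f hf h => ⟨_, coord_mul k i f hf h.2⟩) hf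

theorem homog_le_holPoly (k : ℕ) : homog V k ≤ holPoly := by
  intro f hf
  induction hf using homog_induction with
  | zero => exact zero_mem _
  | const c => exact algebraMap_mem_holPoly c
  | add k f g _ _ hf hg => exact add_mem hf hg
  | coord_mul k i f _ hf => exact mul_mem_holPoly (coord_mem_holPoly _) hf

theorem holPoly_eq_iSup : holPoly = ⨆ k, homog V k := by
  refine le_antisymm ?_ (iSup_le homog_le_holPoly)
  have key : ∀ g ∈ holPolyAlg V, ∃ h : g ∈ realPolyAlg V, RealPoly.mk g h ∈ ⨆ k, homog V k := by
    intro g hg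
    unfold holPolyAlg at hg
    induction hg using Algebra.adjoin_induction with
    | mem x hx =>
      obtain ⟨φ, rfl⟩ := hx
      refine ⟨Algebra.subset_adjoin ⟨φ.restrictScalars ℝ, rfl⟩, ?_⟩
      have h : RealPoly.mk φ (Algebra.subset_adjoin ⟨φ.restrictScalars ℝ, rfl⟩)
          = ∑ i, φ (stdOrthonormalBasis ℂ V i) • coord (stdOrthonormalBasis ℂ V i) := by
        ext z
        change φ z = _
        conv_lhs => rw [← (stdOrthonormalBasis ℂ V).sum_repr' z, map_sum]
        simp [mul_comm]
      rw [h]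
      exact sum_mem fun i _ => Submodule.smul_mem _ _
        (Submodule.mem_iSup_of_mem 1 (coord_mem_homog_one i))
    | algebraMap r =>
      exact ⟨(realPolyAlg V).algebraMap_mem r,
        Submodule.mem_iSup_of_mem 0 (mem_homog_zero.2 ⟨r, rfl⟩)⟩
    | add x y hx hy h1 h2 =>
      obtain ⟨h1, h1'⟩ := h1
      obtain ⟨h2, h2'⟩ := h2
      exact ⟨(realPolyAlg V).add_mem h1 h2, add_mem h1' h2'⟩
    | mul x y hx hy h1 h2 =>
      obtain ⟨h1, h1'⟩ := h1
      obtain ⟨h2, h2'⟩ := h2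
      refine ⟨(realPolyAlg V).mul_mem h1 h2, ?_⟩
      have h := Submodule.mul_mem_mul h1' h2'
      rw [Submodule.iSup_mul] at h
      refine (iSup_le fun k => ?_ : _ ≤ ⨆ k, homog V k) h
      rw [Submodule.mul_iSup]
      refine iSup_le fun l => ?_
      rw [homog, homog, ← pow_add]
      exact le_iSup (homog V) (k + l)
  intro f hf
  obtain ⟨_, h⟩ := key f hf
  exact h

@[elab_as_elim]
theorem holPoly_induction {C : ∀ f : RealPoly V, f ∈ holPoly (V := V) → Prop}
    (zero : C 0 (zero_mem _)) (one : C 1 (algebraMap_mem_holPoly 1))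
    (smul : ∀ (c : ℂ) f hf, C f hf → C (c • f) (Submodule.smul_mem _ c hf))
    (add : ∀ f g hf hg, C f hf → C g hg → C (f + g) (add_mem hf hg))
    (coord_mul : ∀ i f hf, C f hf → C (coord (stdOrthonormalBasis ℂ V i) * f)
      (mul_mem_holPoly (coord_mem_holPoly _) hf))
    {f : RealPoly V} (hf : f ∈ holPoly (V := V)) : C f hf := by
  suffices ∃ h, C f h from this.2
  rw [holPoly_eq_iSup] at hf
  refine Submodule.iSup_induction _ (motive := fun f => ∃ h, C f h) hf (fun k f hf => ?_)
    ⟨_, zero⟩ fun f g h1 h2 => ⟨_, add f g _ _ h1.2 h2.2⟩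
  induction hf using homog_induction with
  | zero => exact ⟨_, zero⟩
  | const c =>
    simp only [Algebra.algebraMap_eq_smul_one]
    exact ⟨Submodule.smul_mem _ c (algebraMap_mem_holPoly 1), smul c 1 _ one⟩
  | add k f g _ _ hf hg => exact ⟨_, add f g _ _ hf.2 hg.2⟩
  | coord_mul k i f hk hf => exact ⟨_, coord_mul i f _ hf.2⟩

theorem delBar_of_mem_holPoly {f : RealPoly V} (hf : f ∈ holPoly (V := V)) (a : V) :
    delBar a f = 0 := by
  rw [holPoly_eq_iSup] at hf
  refine (iSup_le fun k f hf => ?_ :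
    ⨆ k, homog V k ≤ LinearMap.ker (delBar a : RealPoly V →ₗ[ℂ] RealPoly V)) hf
  rw [LinearMap.mem_ker]
  change delBar a f = 0
  induction hf using homog_induction with
  | zero => simp
  | const c => simp
  | add k f g _ _ hf hg => rw [map_add, hf, hg, add_zero]
  | coord_mul k i f _ hf => simp [hf]

theorem del_mem_homog {k : ℕ} {f : RealPoly V} (hf : f ∈ homog V (k + 1)) (a : V) :
    del a f ∈ homog V k := by
  have key : ∀ k (f : RealPoly V), f ∈ homog V k →
      (k = 0 → del a f = 0) ∧ del a f ∈ homog V (k - 1) := by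
    intro k f hf
    induction hf using homog_induction with
    | zero => simp
    | const c => simp
    | add k f g _ _ hf hg =>
      rw [map_add]
      exact ⟨fun h => by rw [hf.1 h, hg.1 h, add_zero], add_mem hf.2 hg.2⟩
    | coord_mul k i f hk hf =>
      refine ⟨fun h => absurd h (Nat.succ_ne_zero k), ?_⟩
      rw [Derivation.leibniz, del_coord, smul_eq_mul, smul_eq_mul, mul_comm f, ← Algebra.smul_def]
      refine add_mem ?_ (Submodule.smul_mem _ _ hk)
      rcases k with _ | k
      · rw [hf.1 rfl, mul_zero]
        exact zero_mem _
      · exact coord_mul_mem_homog i hf.2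
  exact (key _ f hf).2

theorem del_mem_holPoly {f : RealPoly V} (hf : f ∈ holPoly (V := V)) (a : V) :
    del a f ∈ holPoly (V := V) := by
  rw [holPoly_eq_iSup] at hf
  refine (iSup_le fun k f hf => ?_ :
    ⨆ k, homog V k ≤ holPoly.comap (del a : RealPoly V →ₗ[ℂ] RealPoly V)) hf
  change del a f ∈ holPoly
  rcases k with _ | k
  · obtain ⟨c, rfl⟩ := mem_homog_zero.1 hf
    rw [Derivation.map_algebraMap]
    exact zero_mem _
  · exact homog_le_holPoly k (del_mem_homog hf a)

/-- **Euler's formula**. -/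
theorem euler {k : ℕ} {f : RealPoly V} (hf : f ∈ homog V k) :
    ∑ i, coord (stdOrthonormalBasis ℂ V i) * del (stdOrthonormalBasis ℂ V i) f = (k : ℂ) • f := by
  induction hf using homog_induction with
  | zero => simp
  | const c => simp
  | add k f g _ _ hf hg => simp only [map_add, mul_add, Finset.sum_add_distrib, hf, hg, smul_add]
  | coord_mul k i f _ hf =>
    simp only [Derivation.leibniz, smul_eq_mul, mul_add, Finset.sum_add_distrib, del_coord]
    rw [Nat.cast_succ, add_smul, one_smul, ← mul_smul_comm, ← hf, Finset.mul_sum]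
    congr 1
    · refine Finset.sum_congr rfl fun j _ => ?_
      ring
    · rw [Finset.sum_eq_single i]
      · simp [mul_comm]
      · intro j _ hj
        simp [(stdOrthonormalBasis ℂ V).inner_eq_zero hj.symm]
      · simp

theorem homog_finiteDimensional (k : ℕ) : FiniteDimensional ℂ (homog V k) :=
  Module.Finite.iff_fg.2 ((Submodule.fg_span (Set.finite_range _)).pow k)

theorem homog_le_homogPoly {k : ℕ} : homog V k ≤ homogPoly k := by
  intro f hf
  refine ⟨homog_le_holPoly k hf, ?_⟩
  induction hf using homog_induction with
  | zero => simp
  | const c => simp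
  | add k f g _ _ hf hg => intro c z; simp [hf, hg, mul_add]
  | coord_mul k i f _ hf => intro c z; simp [hf]; ring

end Holomorphic

/-! ### The Fischer inner product -/

section Fischer

open RealPoly ComplexConjugate

variable {V : Type*} [NormedAddCommGroup V] [InnerProductSpace ℂ V] [FiniteDimensional ℂ V]
  [MeasurableSpace V] [BorelSpace V]

/-- Multiplication by `z_a` is adjoint to `∂_a` on holomorphic functions. -/
theorem fock_coord_mul {f g : RealPoly V} (hf : f ∈ holPoly (V := V)) (a : V) :
    fock (coord a * f) g = fock f (del a g) := by
  rw [← fock_coord_mul_sub_delBar, delBar_of_mem_holPoly hf, sub_zero]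

theorem fock_del {f g : RealPoly V} (hg : g ∈ holPoly (V := V)) (a : V) :
    fock (del a f) g = fock f (coord a * g) := by
  rw [← fock_conj_symm, ← fock_coord_mul hg, fock_conj_symm]

/-- The inner product `⟨e^{-Δ} F, e^{-Δ} G⟩` for which `∂_a` and `z_a` are adjoint on all polynomial
functions. -/
def fischer (F G : RealPoly V) : ℂ := fock (heat F) (heat G)

theorem fischer_conj_symm (F G : RealPoly V) : conj (fischer F G) = fischer G F :=
  fock_conj_symm _ _

theorem fischer_coord_mul_left (a : V) (F G : RealPoly V) :
    fischer (coord a * F) G = fischer F (del a G) := by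
  rw [fischer, heat_coord_mul, fock_coord_mul_sub_delBar, fischer, heat_del]

theorem fischer_conj_coord_mul_left (a : V) (F G : RealPoly V) :
    fischer ((coord a).conj * F) G = fischer F (delBar a G) := by
  rw [fischer, heat_conj_coord_mul, fock_conj_coord_mul_sub_del, fischer, heat_delBar]

theorem fischer_del_left (a : V) (F G : RealPoly V) :
    fischer (del a F) G = fischer F (coord a * G) := by
  rw [← fischer_conj_symm, ← fischer_coord_mul_left, fischer_conj_symm]

theorem fischer_delBar_left (a : V) (F G : RealPoly V) :
    fischer (delBar a F) G = fischer F ((coord a).conj * G) := by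
  rw [← fischer_conj_symm, ← fischer_conj_coord_mul_left, fischer_conj_symm]

theorem fischer_add_left (F G H : RealPoly V) : fischer (F + G) H = fischer F H + fischer G H := by
  rw [fischer, map_add, fock_add_left]; rfl

theorem fischer_add_right (F G H : RealPoly V) : fischer F (G + H) = fischer F G + fischer F H := by
  rw [fischer, map_add, fock_add_right]; rfl

theorem fischer_smul_left (c : ℂ) (F G : RealPoly V) : fischer (c • F) G = c * fischer F G := by
  rw [fischer, map_smul, fock_smul_left]; rfl

theorem fischer_smul_right (c : ℂ) (F G : RealPoly V) :
    fischer F (c • G) = conj c * fischer F G := by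
  rw [fischer, map_smul, fock_smul_right]; rfl

@[simp] theorem fischer_zero_left (F : RealPoly V) : fischer 0 F = 0 := by simp [fischer]

@[simp] theorem fischer_zero_right (F : RealPoly V) : fischer F 0 = 0 := by simp [fischer]

theorem fischer_sum_left {ι : Type*} (s : Finset ι) (F : ι → RealPoly V) (G : RealPoly V) :
    fischer (∑ i ∈ s, F i) G = ∑ i ∈ s, fischer (F i) G := by
  rw [fischer, map_sum, fock_sum_left]; rfl

theorem fischer_sum_right {ι : Type*} (s : Finset ι) (F : RealPoly V) (G : ι → RealPoly V) :
    fischer F (∑ i ∈ s, G i) = ∑ i ∈ s, fischer F (G i) := by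
  rw [fischer, map_sum, fock_sum_right]; rfl

theorem eq_zero_of_fischer_self {F : RealPoly V} (h : fischer F F = 0) : F = 0 :=
  heat_injective (eq_zero_of_fock_self h)

/-- On products `f ḡ` of holomorphic and antiholomorphic polynomials, the Fischer inner product is
the tensor product of the Fock inner products. -/
theorem fischer_mul_conj {f g h k : RealPoly V} (hf : f ∈ holPoly (V := V))
    (hg : g ∈ holPoly (V := V)) (hh : h ∈ holPoly (V := V)) (hk : k ∈ holPoly (V := V)) :
    fischer (f * g.conj) (h * k.conj) = fock f h * fock k g := by
  have del_mul : ∀ (a : V) {h k : RealPoly V}, k ∈ holPoly (V := V) →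
      del a (h * k.conj) = del a h * k.conj := fun a h k hk => by
    rw [Derivation.leibniz, del_conj, delBar_of_mem_holPoly hk]
    simp [mul_comm]
  have delBar_mul : ∀ (a : V) {h k : RealPoly V}, h ∈ holPoly (V := V) →
      delBar a (h * k.conj) = h * (del a k).conj := fun a h k hk => by
    rw [Derivation.leibniz, delBar_conj, delBar_of_mem_holPoly hk]
    simp
  have heat_one : heat (1 : RealPoly V) = 1 :=
    heat_of_laplace_eq_zero (by simp [laplace_apply])
  induction hf using holPoly_induction generalizing h with
  | zero => simp
  | smul c f _ hf => rw [smul_mul_assoc, fischer_smul_left, hf hh, fock_smul_left, mul_assoc]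
  | add f₁ f₂ _ _ h1 h2 => rw [add_mul, fischer_add_left, h1 hh, h2 hh, fock_add_left, add_mul]
  | coord_mul i f hf ih =>
    rw [mul_assoc, fischer_coord_mul_left, del_mul _ hk, ih (del_mem_holPoly hh _),
      fock_coord_mul hf]
  | one =>
  induction hg using holPoly_induction generalizing k with
  | zero => simp
  | smul c g _ hg =>
    rw [conj_smul, mul_smul_comm, fischer_smul_left, hg hk, fock_smul_right, mul_left_comm]
  | add g₁ g₂ _ _ h1 h2 =>
    rw [conj_add, mul_add, fischer_add_left, h1 hk, h2 hk, fock_add_right, mul_add]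
  | coord_mul i g hg ih =>
    rw [RealPoly.conj_mul, mul_left_comm, fischer_conj_coord_mul_left, delBar_mul _ hh,
      ih (del_mem_holPoly hk _), fock_del hg]
  | one =>
  rw [conj_one, mul_one]
  induction hh using holPoly_induction with
  | zero => simp
  | smul c h _ hh =>
    rw [smul_mul_assoc, fischer_smul_right, hh, fock_smul_right, mul_assoc]
  | add h₁ h₂ _ _ h1 h2 => rw [add_mul, fischer_add_right, h1, h2, fock_add_right, add_mul]
  | coord_mul i h hh ih =>
    rw [mul_assoc, ← fischer_del_left, ← fock_del hh]
    simp
  | one =>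
  induction hk using holPoly_induction with
  | zero => simp
  | smul c k _ hk =>
    rw [conj_smul, mul_smul_comm, fischer_smul_right, hk, fock_smul_left, Complex.conj_conj,
      mul_left_comm]
  | add k₁ k₂ _ _ h1 h2 => rw [conj_add, mul_add, fischer_add_right, h1, h2, fock_add_left, mul_add]
  | coord_mul i k hk ih =>
    rw [RealPoly.conj_mul, mul_left_comm, ← fischer_delBar_left, fock_coord_mul hk]
    simp
  | one => simp [fischer, heat_one, fock_one_one]

theorem fock_homog_of_ne {k l : ℕ} (hkl : k ≠ l) {f g : RealPoly V} (hf : f ∈ homog V k)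
    (hg : g ∈ homog V l) : fock f g = 0 := by
  have h1 : fock ((k : ℂ) • f) g = fock f ((l : ℂ) • g) := by
    rw [← euler hf, ← euler hg, fock_sum_left, fock_sum_right]
    refine Finset.sum_congr rfl fun i _ => ?_
    rw [← fock_del (homog_le_holPoly l hg |> del_mem_holPoly <| _)]
    rcases k with _ | k
    · obtain ⟨c, rfl⟩ := mem_homog_zero.1 hf
      simp
    · rw [fock_coord_mul (homog_le_holPoly k (del_mem_homog hf _))]
  rw [fock_smul_left, fock_smul_right] at h1
  have h2 : ((k : ℂ) - l) * fock f g = 0 := by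
    rw [sub_mul, h1]; simp
  exact (mul_eq_zero.1 h2).resolve_left (sub_ne_zero.2 (Nat.cast_injective.ne hkl))

/-- A holomorphic polynomial orthogonal to all degrees other than `k` is homogeneous of degree
`k`. -/
theorem mem_homog_of_fock {k : ℕ} {x : RealPoly V} (hx : x ∈ holPoly (V := V))
    (h : ∀ l ≠ k, ∀ y ∈ homog V l, fock x y = 0) : x ∈ homog V k := by
  rw [holPoly_eq_iSup, iSup_split_single _ k] at hx
  obtain ⟨y, hy, r, hr, rfl⟩ := Submodule.mem_sup.1 hx
  suffices r = 0 by rwa [this, add_zero]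
  refine eq_zero_of_fock_self ?_
  suffices ∀ s ∈ ⨆ (l) (_ : l ≠ k), homog V l, fock r s = 0 from this r hr
  intro s hs
  rw [iSup_subtype'] at hs
  refine Submodule.iSup_induction _ (motive := fun s => fock r s = 0) hs (fun l s hs => ?_)
    (fock_zero_right r) fun y z h1 h2 => by rw [fock_add_right, h1, h2, add_zero]
  have h1 := h l l.2 s hs
  rwa [fock_add_left, fock_homog_of_ne l.2.symm hy hs, zero_add] at h1

end Fischer

/-! ### The action of the group -/

section Action

open RealPoly ComplexConjugate

variable {V : Type*} [NormedAddCommGroup V] [InnerProductSpace ℂ V] [CompleteSpace V]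
  {K : Subgroup (unitary (V →L[ℂ] V))}

@[simp] theorem polyRep_apply (k : K) (f : RealPoly V) (z : V) :
    polyRep K k f z = f (((k⁻¹ : K) : V →L[ℂ] V) z) := rfl

theorem polyRep_mul (k : K) (f g : RealPoly V) :
    polyRep K k (f * g) = polyRep K k f * polyRep K k g := rfl

theorem polyRep_conj (k : K) (f : RealPoly V) : polyRep K k f.conj = (polyRep K k f).conj := rfl

theorem polyRep_inv_self (k : K) (f : RealPoly V) : polyRep K k (polyRep K k⁻¹ f) = f := by
  rw [← Module.End.mul_apply, ← map_mul, mul_inv_cancel, map_one, Module.End.one_apply]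

variable (K) in
/-- The operator `k⁻¹` as a linear isometry of `V`. -/
def invIsometry (k : K) : V ≃ₗᵢ[ℂ] V :=
  Unitary.linearIsometryEquiv ((k⁻¹ : K) : unitary (V →L[ℂ] V))

theorem invIsometry_apply (k : K) (z : V) : invIsometry K k z = ((k⁻¹ : K) : V →L[ℂ] V) z := rfl

theorem dirDeriv_polyRep (k : K) (a : V) (f : RealPoly V) :
    dirDeriv a (polyRep K k f) = polyRep K k (dirDeriv (((k⁻¹ : K) : V →L[ℂ] V) a) f) := by
  ext z
  have h := ((f.differentiable (((k⁻¹ : K) : V →L[ℂ] V) z)).hasFDerivAt.comp z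
    ((((k⁻¹ : K) : V →L[ℂ] V).restrictScalars ℝ).hasFDerivAt)).fderiv
  exact congrArg (fun L : V →L[ℝ] ℂ => L a) h

theorem del_polyRep (k : K) (a : V) (f : RealPoly V) :
    del a (polyRep K k f) = polyRep K k (del (((k⁻¹ : K) : V →L[ℂ] V) a) f) := by
  simp only [del_apply, dirDeriv_polyRep, map_smul, map_sub]

theorem delBar_polyRep (k : K) (a : V) (f : RealPoly V) :
    delBar a (polyRep K k f) = polyRep K k (delBar (((k⁻¹ : K) : V →L[ℂ] V) a) f) := by
  simp only [delBar_apply, dirDeriv_polyRep, map_smul, map_add]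

theorem polyRep_coord (k : K) (a : V) :
    polyRep K k (coord a) = coord ((invIsometry K k).symm a) := by
  ext z
  rw [polyRep_apply, coord_apply, coord_apply, ← invIsometry_apply,
    ← (invIsometry K k).inner_map_map ((invIsometry K k).symm a) z,
    LinearIsometryEquiv.apply_symm_apply]

variable [FiniteDimensional ℂ V]

theorem laplace_polyRep (k : K) (f : RealPoly V) :
    laplace (polyRep K k f) = polyRep K k (laplace f) := by
  rw [laplace_apply, laplace_eq ((stdOrthonormalBasis ℂ V).map (invIsometry K k)), map_sum]
  simp only [delBar_polyRep, del_polyRep, OrthonormalBasis.map_apply, invIsometry_apply]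

theorem heat_polyRep (k : K) (f : RealPoly V) : heat (polyRep K k f) = polyRep K k (heat f) :=
  heat_comm (laplace_polyRep k) f

variable [MeasurableSpace V] [BorelSpace V]

theorem fock_polyRep (k : K) (f g : RealPoly V) :
    fock (polyRep K k f) (polyRep K k g) = fock f g := by
  have hm : MeasurePreserving (invIsometry K k) (lebesgue V) (lebesgue V) := by
    let : InnerProductSpace ℝ V := InnerProductSpace.rclikeToReal ℂ V
    let e : V ≃ₗᵢ[ℝ] V :=
      { (invIsometry K k).toLinearEquiv.restrictScalars ℝ with
        norm_map' := (invIsometry K k).norm_map }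
    exact e.measurePreserving
  unfold fock
  congr 1
  conv_rhs => rw [← hm.integral_comp (invIsometry K k).toHomeomorph.measurableEmbedding]
  simp only [LinearIsometryEquiv.norm_map]
  rfl

theorem fischer_polyRep (k : K) (F G : RealPoly V) :
    fischer (polyRep K k F) (polyRep K k G) = fischer F G := by
  rw [fischer, heat_polyRep, heat_polyRep, fock_polyRep, fischer]

end Action

section Form

open ComplexConjugate

variable {V : Type*} [NormedAddCommGroup V] [InnerProductSpace ℂ V] [FiniteDimensional ℂ V]
  [MeasurableSpace V] [BorelSpace V]

/-- The sesquilinear form `⟨T x, y⟩` of the Fock inner product. -/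
def fockForm (T : Module.End ℂ (RealPoly V)) : RealPoly V →ₗ[ℂ] RealPoly V →ₗ⋆[ℂ] ℂ :=
  LinearMap.mk₂'ₛₗ (RingHom.id ℂ) (starRingEnd ℂ) (fun x y => fock (T x) y)
    (fun x y z => by rw [map_add, fock_add_left])
    (fun c x y => by rw [map_smul, fock_smul_left]; rfl)
    (fun x y z => fock_add_right _ _ _) (fun c x y => fock_smul_right _ _ _)

theorem fockForm_apply (T : Module.End ℂ (RealPoly V)) (x y : RealPoly V) :
    fockForm T x y = fock (T x) y := rfl

end Form

/-! ### Schur's lemma and the homogeneity of the summands -/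

namespace MultFreeDecomposition

open RealPoly ComplexConjugate

variable {V : Type*} [NormedAddCommGroup V] [InnerProductSpace ℂ V] [CompleteSpace V]
  {K : Subgroup (unitary (V →L[ℂ] V))} {Λ : Type*} (D : MultFreeDecomposition K Λ)

theorem le_holPoly (a : Λ) : (D.P a).toSubmodule ≤ holPoly := by
  rw [← D.iSup_eq]
  exact le_iSup (fun a => (D.P a).toSubmodule) a

theorem exists_ne_zero (a : Λ) : ∃ x ∈ (D.P a).toSubmodule, x ≠ 0 := by
  have h := D.irreducible a
  by_contra! hx
  have : (⊥ : Subrepresentation (D.P a).toRepresentation) = ⊤ := by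
    refine Subrepresentation.toSubmodule_injective (Submodule.ext fun x => ?_)
    exact ⟨fun _ => Submodule.mem_top, fun _ => (Submodule.mem_bot ℂ).2 (Subtype.ext (hx x x.2))⟩
  exact bot_ne_top this

theorem dim_pos (a : Λ) : 0 < D.dim a := by
  obtain ⟨x, hx, hx0⟩ := D.exists_ne_zero a
  have : Nontrivial (D.P a).toSubmodule := ⟨⟨⟨x, hx⟩, 0, fun h => hx0 (congrArg Subtype.val h)⟩⟩
  exact finrank_pos

theorem dim_ne_zero (a : Λ) : (D.dim a : ℂ) ≠ 0 := Nat.cast_ne_zero.2 (D.dim_pos a).ne'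

variable [FiniteDimensional ℂ V] [MeasurableSpace V] [BorelSpace V]

/-- The elements of an orthonormal basis of `P_a`. -/
def onb (a : Λ) (j : Fin (D.dim a)) : RealPoly V :=
  (stdOrthonormalBasis ℂ (D.P a).toSubmodule j : RealPoly V)

theorem onb_mem (a : Λ) (j : Fin (D.dim a)) : D.onb a j ∈ (D.P a).toSubmodule :=
  (stdOrthonormalBasis ℂ (D.P a).toSubmodule j).2

theorem fock_onb (a : Λ) (i j : Fin (D.dim a)) :
    fock (D.onb a i) (D.onb a j) = if j = i then 1 else 0 :=
  (stdOrthonormalBasis ℂ (D.P a).toSubmodule).inner_eq_ite j i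

theorem sum_fock_onb {a : Λ} {x : RealPoly V} (hx : x ∈ (D.P a).toSubmodule) :
    ∑ j, fock x (D.onb a j) • D.onb a j = x := by
  have h := congrArg Subtype.val
    ((stdOrthonormalBasis ℂ (D.P a).toSubmodule).sum_repr' ⟨x, hx⟩)
  rw [Submodule.coe_sum] at h
  exact h

theorem p_eq (a : Λ) : D.p a = (D.dim a : ℂ)⁻¹ • ∑ j, D.onb a j * (D.onb a j).conj := rfl

/-- Riesz representation of an invariant sesquilinear form on `P_a × P_b` by an intertwining map. -/
theorem exists_intertwiningMap (a b : Λ) (B : RealPoly V →ₗ[ℂ] RealPoly V →ₗ⋆[ℂ] ℂ)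
    (hB : ∀ k : K, ∀ x y, B (polyRep K k x) (polyRep K k y) = B x y) :
    ∃ T : Representation.IntertwiningMap (D.P a).toRepresentation (D.P b).toRepresentation,
      ∀ (x : (D.P a).toSubmodule), ∀ y ∈ (D.P b).toSubmodule,
        B x y = fock (T x : RealPoly V) y := by
  let T₀ : (D.P a).toSubmodule →ₗ[ℂ] (D.P b).toSubmodule :=
    { toFun := fun x => ∑ j, B x (D.onb b j) • stdOrthonormalBasis ℂ (D.P b).toSubmodule j
      map_add' := fun x y => by
        simp only [Submodule.coe_add, map_add, LinearMap.add_apply, add_smul,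
          Finset.sum_add_distrib]
      map_smul' := fun c x => by
        simp only [Submodule.coe_smul, map_smul, LinearMap.smul_apply, smul_assoc,
          Finset.smul_sum, RingHom.id_apply] }
  have hT₀ : ∀ (x : (D.P a).toSubmodule), ∀ y ∈ (D.P b).toSubmodule,
      B x y = fock (T₀ x : RealPoly V) y := by
    intro x y hy
    have h1 : (T₀ x : RealPoly V) = ∑ j, B x (D.onb b j) • D.onb b j := by
      change ((∑ j, B x (D.onb b j) • stdOrthonormalBasis ℂ (D.P b).toSubmodule j :
        (D.P b).toSubmodule) : RealPoly V) = _
      rw [Submodule.coe_sum]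
      rfl
    rw [h1, fock_sum_left]
    conv_lhs => rw [← D.sum_fock_onb hy, map_sum]
    refine Finset.sum_congr rfl fun j _ => ?_
    rw [LinearMap.map_smulₛₗ, fock_smul_left, fock_conj_symm, smul_eq_mul, mul_comm]
  refine ⟨T₀.intertwiningMap_of_isIntertwiningMap _ _ fun k x => ?_, hT₀⟩
  rw [← sub_eq_zero]
  refine Subtype.ext (eq_zero_of_fock_self ?_)
  have h2 : ∀ y ∈ (D.P b).toSubmodule, fock
      ((T₀ ((D.P a).toRepresentation k x) - (D.P b).toRepresentation k (T₀ x) :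
        (D.P b).toSubmodule) : RealPoly V) y = 0 := by
    intro y hy
    rw [Submodule.coe_sub, fock_sub_left, ← hT₀ _ y hy, sub_eq_zero]
    change B (polyRep K k x) y = fock (polyRep K k (T₀ x)) y
    rw [← polyRep_inv_self k y, hB, fock_polyRep,
      hT₀ _ _ ((D.P b).apply_mem_toSubmodule _ hy)]
  exact h2 _ (Subtype.property _)

/-- Invariant sesquilinear forms pair inequivalent summands trivially. -/
theorem form_eq_zero {a b : Λ} (hab : a ≠ b) (B : RealPoly V →ₗ[ℂ] RealPoly V →ₗ⋆[ℂ] ℂ)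
    (hB : ∀ k : K, ∀ x y, B (polyRep K k x) (polyRep K k y) = B x y) {x y : RealPoly V}
    (hx : x ∈ (D.P a).toSubmodule) (hy : y ∈ (D.P b).toSubmodule) : B x y = 0 := by
  obtain ⟨T, hT⟩ := D.exists_intertwiningMap a b B hB
  have := D.irreducible a
  have := D.irreducible b
  have := D.inequivalent a b hab
  have hT0 : T = 0 := Subsingleton.elim _ _
  rw [hT ⟨x, hx⟩ y hy, hT0]
  simp

/-- Invariant sesquilinear forms on an irreducible summand are multiples of the inner product. -/
theorem exists_form_eq_mul (a : Λ) (B : RealPoly V →ₗ[ℂ] RealPoly V →ₗ⋆[ℂ] ℂ)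
    (hB : ∀ k : K, ∀ x y, B (polyRep K k x) (polyRep K k y) = B x y) :
    ∃ c : ℂ, ∀ x ∈ (D.P a).toSubmodule, ∀ y ∈ (D.P a).toSubmodule, B x y = c * fock x y := by
  obtain ⟨T, hT⟩ := D.exists_intertwiningMap a a B hB
  have := D.irreducible a
  obtain ⟨c, hc⟩ := (Representation.IsIrreducible.algebraMap_intertwiningMap_bijective_of_isAlgClosed
    (ρ := (D.P a).toRepresentation)).2 T
  refine ⟨c, fun x hx y hy => ?_⟩
  rw [hT ⟨x, hx⟩ y hy, ← hc, ← fock_smul_left]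
  rfl

theorem fock_eq_zero {a b : Λ} (hab : a ≠ b) {x y : RealPoly V}
    (hx : x ∈ (D.P a).toSubmodule) (hy : y ∈ (D.P b).toSubmodule) : fock x y = 0 :=
  D.form_eq_zero hab (fockForm 1) (fun k x y => fock_polyRep k x y) hx hy

/-- A holomorphic polynomial orthogonal to all summands vanishes. -/
theorem eq_zero_of_fock {x : RealPoly V} (hx : x ∈ holPoly (V := V))
    (h : ∀ b, ∀ y ∈ (D.P b).toSubmodule, fock x y = 0) : x = 0 := by
  refine eq_zero_of_fock_self ?_
  suffices ∀ y ∈ holPoly (V := V), fock x y = 0 from this x hx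
  intro y hy
  rw [← D.iSup_eq] at hy
  refine Submodule.iSup_induction _ (motive := fun y => fock x y = 0) hy (fun b y hy => h b y hy)
    (fock_zero_right x) fun y z h1 h2 => by rw [fock_add_right, h1, h2, add_zero]

end MultFreeDecomposition

section Dilation

variable {V : Type*} [NormedAddCommGroup V] [InnerProductSpace ℂ V]

/-- The operator `f ↦ f(2 ·)`; it commutes with the group and separates the degrees. -/
def dilation : Module.End ℂ (RealPoly V) where
  toFun f := RealPoly.mk (fun z => f ((2 : ℂ) • z))
    (RealPoly.comp_mem f.mem (((2 : ℂ) • ContinuousLinearMap.id ℂ V).restrictScalars ℝ))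
  map_add' _ _ := rfl
  map_smul' _ _ := rfl

theorem dilation_apply (f : RealPoly V) (z : V) : dilation f z = f ((2 : ℂ) • z) := rfl

theorem dilation_polyRep [CompleteSpace V] {K : Subgroup (unitary (V →L[ℂ] V))} (k : K)
    (f : RealPoly V) : dilation (polyRep K k f) = polyRep K k (dilation f) := by
  ext z
  simp [dilation_apply]

theorem dilation_of_mem_homogPoly {f : RealPoly V} {k : ℕ} (hf : f ∈ homogPoly k) :
    dilation f = (2 : ℂ) ^ k • f := by
  ext z
  exact hf.2 2 z

variable [FiniteDimensional ℂ V]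

theorem dilation_mem_holPoly {f : RealPoly V} (hf : f ∈ holPoly (V := V)) :
    dilation f ∈ holPoly (V := V) := by
  rw [holPoly_eq_iSup] at hf
  refine (iSup_le fun k f hf => ?_ : ⨆ k, homog V k ≤ holPoly.comap dilation) hf
  rw [Submodule.mem_comap, dilation_of_mem_homogPoly (homog_le_homogPoly hf)]
  exact Submodule.smul_mem _ _ (homog_le_holPoly k hf)

variable [MeasurableSpace V] [BorelSpace V]

theorem fock_dilation {f g : RealPoly V} {k : ℕ} (hf : f ∈ holPoly (V := V)) (hg : g ∈ homog V k) :
    fock (dilation f) g = 2 ^ k * fock f g := by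
  rw [holPoly_eq_iSup] at hf
  refine Submodule.iSup_induction _ (motive := fun f => fock (dilation f) g = 2 ^ k * fock f g) hf
    (fun l f hf => ?_) (by simp) fun x y h1 h2 => by
      rw [map_add, fock_add_left, h1, h2, fock_add_left, mul_add]
  rw [dilation_of_mem_homogPoly (homog_le_homogPoly hf), fock_smul_left]
  by_cases hkl : l = k
  · rw [hkl]
  · rw [fock_homog_of_ne hkl hf hg, mul_zero, mul_zero]

end Dilation

namespace MultFreeDecomposition

open RealPoly ComplexConjugate

variable {V : Type*} [NormedAddCommGroup V] [InnerProductSpace ℂ V] [CompleteSpace V]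
  {K : Subgroup (unitary (V →L[ℂ] V))} {Λ : Type*} (D : MultFreeDecomposition K Λ)
  [FiniteDimensional ℂ V] [MeasurableSpace V] [BorelSpace V]

/-- The dilation by `2` commutes with `K`, hence is a scalar on `P_a`; an element with a nonzero
component of degree `k` shows that the scalar is `2 ^ k`. -/
theorem exists_le_homog (a : Λ) : ∃ k, (D.P a).toSubmodule ≤ homog V k := by
  have hinv : ∀ k : K, ∀ x y : RealPoly V,
      fockForm dilation (polyRep K k x) (polyRep K k y) = fockForm dilation x y := fun k x y => by
    rw [fockForm_apply, dilation_polyRep, fock_polyRep, fockForm_apply]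
  obtain ⟨c, hc⟩ := D.exists_form_eq_mul a (fockForm dilation) hinv
  have hdil : ∀ x ∈ (D.P a).toSubmodule, dilation x = c • x := by
    intro x hx
    rw [← sub_eq_zero]
    refine D.eq_zero_of_fock (sub_mem (dilation_mem_holPoly (D.le_holPoly a hx))
      (Submodule.smul_mem _ _ (D.le_holPoly a hx))) fun b y hy => ?_
    rw [fock_sub_left, fock_smul_left, sub_eq_zero]
    by_cases hab : a = b
    · subst hab
      exact hc x hx y hy
    · rw [D.fock_eq_zero hab hx hy, mul_zero]
      exact D.form_eq_zero hab (fockForm dilation) hinv hx hy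
  have hmul : ∀ x ∈ (D.P a).toSubmodule, ∀ k, ∀ y ∈ homog V k, fock x y ≠ 0 → c = 2 ^ k := by
    intro x hx k y hy hne
    have h := fock_dilation (D.le_holPoly a hx) hy
    rw [hdil x hx, fock_smul_left] at h
    exact mul_right_cancel₀ hne h
  obtain ⟨x, hx, hx0⟩ := D.exists_ne_zero a
  obtain ⟨k, y, hy, hxy⟩ : ∃ k, ∃ y ∈ homog V k, fock x y ≠ 0 := by
    by_contra! h
    refine hx0 (eq_zero_of_fock_self ?_)
    have hx' := D.le_holPoly a hx
    rw [holPoly_eq_iSup] at hx'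
    refine Submodule.iSup_induction _ (motive := fun y => fock x y = 0) hx' (fun k y hy => h k y hy)
      (fock_zero_right x) fun y z h1 h2 => by rw [fock_add_right, h1, h2, add_zero]
  have hck := hmul x hx k y hy hxy
  refine ⟨k, fun x hx => mem_homog_of_fock (D.le_holPoly a hx) fun l hl y hy => ?_⟩
  by_contra hne
  have h : (2 : ℂ) ^ k = 2 ^ l := by rw [← hck, hmul x hx l y hy hne]
  exact hl (Nat.pow_right_injective le_rfl (by exact_mod_cast h.symm))

theorem le_homog_deg (a : Λ) : (D.P a).toSubmodule ≤ homog V (D.deg a) := by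
  obtain ⟨k, hk⟩ := D.exists_le_homog a
  suffices D.deg a = k by rwa [this]
  have : {m | (D.P a).toSubmodule ≤ homogPoly m} = {k} := by
    ext m
    refine ⟨fun hm => ?_, fun hm => ?_⟩
    · obtain ⟨x, hx, hx0⟩ := D.exists_ne_zero a
      have h := (dilation_of_mem_homogPoly (hm hx)).symm.trans
        (dilation_of_mem_homogPoly (homog_le_homogPoly (hk hx)))
      have h' := smul_left_injective ℂ hx0 h
      exact Nat.pow_right_injective le_rfl (by exact_mod_cast h')
    · rw [Set.mem_singleton_iff.1 hm]
      exact hk.trans homog_le_homogPoly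
  rw [deg, this, csInf_singleton]

theorem finite_deg_eq (m : ℕ) : {a | D.deg a = m}.Finite := by
  have := homog_finiteDimensional (V := V) m
  choose x hx hx0 using D.exists_ne_zero
  let v : {a | D.deg a = m} → homog V m := fun a =>
    ⟨x a, by
      have h := D.le_homog_deg a (hx a)
      rwa [show D.deg a = m from a.2] at h⟩
  have hv : LinearIndependent ℂ v := by
    refine linearIndependent_of_ne_zero_of_inner_eq_zero
      (fun a h => hx0 a (congrArg Subtype.val h)) fun a b hab => ?_
    exact D.fock_eq_zero (fun h => hab (Subtype.ext h.symm)) (hx b) (hx a)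
  have := hv.finite
  exact Set.toFinite _

/-- The summands of degree `m`. -/
def level (m : ℕ) : Finset Λ := (D.finite_deg_eq m).toFinset

theorem mem_level {m : ℕ} {a : Λ} : a ∈ D.level m ↔ D.deg a = m := by simp [level]

end MultFreeDecomposition

/-! ### Bihomogeneous polynomials -/

section Bihomog

open RealPoly ComplexConjugate

variable {V : Type*} [NormedAddCommGroup V] [InnerProductSpace ℂ V] [FiniteDimensional ℂ V]

variable (V) in
/-- The polynomial functions of bidegree `(m, m)` in `z` and `z̄`. -/
def bihomog (m : ℕ) : Submodule ℂ (RealPoly V) :=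
  Submodule.span ℂ {F | ∃ f ∈ homog V m, ∃ g ∈ homog V m, f * g.conj = F}

theorem mul_conj_mem_bihomog {m : ℕ} {f g : RealPoly V} (hf : f ∈ homog V m) (hg : g ∈ homog V m) :
    f * g.conj ∈ bihomog V m := Submodule.subset_span ⟨f, hf, g, hg, rfl⟩

variable (V) in
/-- The polynomial `z ↦ ⟨z, z⟩`. -/
def normSq : RealPoly V :=
  ∑ i, coord (stdOrthonormalBasis ℂ V i) * (coord (stdOrthonormalBasis ℂ V i)).conj

theorem normSq_apply (z : V) : normSq V z = (‖z‖ : ℂ) ^ 2 := by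
  simp only [normSq, RealPoly.sum_apply, RealPoly.mul_apply, RealPoly.conj_apply, coord_apply,
    Complex.mul_conj']
  exact_mod_cast congrArg (Complex.ofReal) ((stdOrthonormalBasis ℂ V).sum_sq_norm_inner_right z)

theorem polyRep_normSq [CompleteSpace V] {K : Subgroup (unitary (V →L[ℂ] V))} (k : K) :
    polyRep K k (normSq V) = normSq V := by
  ext z
  rw [polyRep_apply, normSq_apply, normSq_apply, ← invIsometry_apply,
    LinearIsometryEquiv.norm_map]

theorem coord_mem_homog (a : V) : coord a ∈ homog V 1 := by
  have h : coord a = ∑ i, inner ℂ a (stdOrthonormalBasis ℂ V i) •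
      coord (stdOrthonormalBasis ℂ V i) := by
    ext z
    simp only [RealPoly.sum_apply, RealPoly.smul_apply, coord_apply]
    exact ((stdOrthonormalBasis ℂ V).sum_inner_mul_inner a z).symm
  rw [h]
  exact sum_mem fun i _ => Submodule.smul_mem _ _ (coord_mem_homog_one i)

theorem polyRep_mem_homog [CompleteSpace V] {K : Subgroup (unitary (V →L[ℂ] V))} (k : K) {m : ℕ}
    {f : RealPoly V} (hf : f ∈ homog V m) : polyRep K k f ∈ homog V m := by
  induction hf using homog_induction with
  | zero => rw [map_zero]; exact zero_mem _
  | const c => exact mem_homog_zero.2 ⟨c, rfl⟩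
  | add m f g _ _ hf hg => rw [map_add]; exact add_mem hf hg
  | coord_mul m i f _ hf =>
    rw [polyRep_mul, polyRep_coord, add_comm]
    exact mul_mem_homog (coord_mem_homog _) hf

theorem polyRep_mem_bihomog [CompleteSpace V] {K : Subgroup (unitary (V →L[ℂ] V))} (k : K) {m : ℕ}
    {F : RealPoly V} (hF : F ∈ bihomog V m) : polyRep K k F ∈ bihomog V m := by
  refine (Submodule.span_le.2 ?_ : bihomog V m ≤ (bihomog V m).comap (polyRep K k)) hF
  rintro _ ⟨f, hf, g, hg, rfl⟩
  exact mul_conj_mem_bihomog (polyRep_mem_homog k hf) (polyRep_mem_homog k hg)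

theorem laplace_mul_conj {f g : RealPoly V} (hf : f ∈ holPoly (V := V))
    (hg : g ∈ holPoly (V := V)) : laplace (f * g.conj) =
      ∑ i, del (stdOrthonormalBasis ℂ V i) f * (del (stdOrthonormalBasis ℂ V i) g).conj := by
  rw [laplace_apply]
  refine Finset.sum_congr rfl fun i _ => ?_
  rw [Derivation.leibniz, delBar_of_mem_holPoly hf, smul_zero, add_zero, smul_eq_mul,
    Derivation.leibniz, delBar_conj, del_conj,
    delBar_of_mem_holPoly (del_mem_holPoly hg _), conj_zero, smul_zero, zero_add, smul_eq_mul,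
    mul_comm]

theorem normSq_mul (F : RealPoly V) : normSq V * F =
    ∑ i, coord (stdOrthonormalBasis ℂ V i) * ((coord (stdOrthonormalBasis ℂ V i)).conj * F) := by
  rw [normSq, Finset.sum_mul]
  simp only [mul_assoc]

theorem normSq_mul_mul_conj (f g : RealPoly V) : normSq V * (f * g.conj) =
    ∑ i, (coord (stdOrthonormalBasis ℂ V i) * f)
      * (coord (stdOrthonormalBasis ℂ V i) * g).conj := by
  rw [normSq, Finset.sum_mul]
  refine Finset.sum_congr rfl fun i _ => ?_
  rw [RealPoly.conj_mul]
  ring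

theorem laplace_mem_bihomog {m : ℕ} {F : RealPoly V} (hF : F ∈ bihomog V (m + 1)) :
    laplace F ∈ bihomog V m := by
  refine (Submodule.span_le.2 ?_ : bihomog V (m + 1) ≤ (bihomog V m).comap laplace) hF
  rintro _ ⟨f, hf, g, hg, rfl⟩
  change laplace _ ∈ bihomog V m
  rw [laplace_mul_conj (homog_le_holPoly _ hf) (homog_le_holPoly _ hg)]
  exact sum_mem fun i _ => mul_conj_mem_bihomog (del_mem_homog hf _) (del_mem_homog hg _)

theorem mem_bihomog_zero {F : RealPoly V} (hF : F ∈ bihomog V 0) :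
    ∃ c : ℂ, F = algebraMap ℂ _ c := by
  suffices bihomog V 0 ≤ 1 by
    obtain ⟨c, hc⟩ := Submodule.mem_one.1 (this hF)
    exact ⟨c, hc.symm⟩
  refine Submodule.span_le.2 ?_
  rintro _ ⟨f, hf, g, hg, rfl⟩
  obtain ⟨c, rfl⟩ := mem_homog_zero.1 hf
  obtain ⟨d, rfl⟩ := mem_homog_zero.1 hg
  exact Submodule.mem_one.2 ⟨c * conj d, by ext z; simp⟩

theorem laplace_pow_mem_bihomog {m : ℕ} (k : ℕ) {F : RealPoly V} (hF : F ∈ bihomog V (m + k)) :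
    (laplace ^ k) F ∈ bihomog V m := by
  induction k generalizing F with
  | zero => exact hF
  | succ k ih =>
    rw [pow_succ, Module.End.mul_apply]
    exact ih (laplace_mem_bihomog hF)

theorem laplace_pow_eq_zero {m k : ℕ} (hk : m < k) {F : RealPoly V} (hF : F ∈ bihomog V m) :
    (laplace ^ k) F = 0 := by
  obtain ⟨j, rfl⟩ := Nat.exists_eq_add_of_lt hk
  obtain ⟨c, hc⟩ := mem_bihomog_zero (laplace_pow_mem_bihomog (m := 0) m (by rwa [zero_add]))
  rw [show m + j + 1 = j + (1 + m) by ring, pow_add, Module.End.mul_apply, pow_add,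
    Module.End.mul_apply, hc]
  simp [laplace_apply]

theorem normSq_mul_mem_bihomog {m : ℕ} {F : RealPoly V} (hF : F ∈ bihomog V m) :
    normSq V * F ∈ bihomog V (m + 1) := by
  refine (Submodule.span_le.2 ?_ :
    bihomog V m ≤ (bihomog V (m + 1)).comap (LinearMap.mulLeft ℂ (normSq V))) hF
  rintro _ ⟨f, hf, g, hg, rfl⟩
  change normSq V * _ ∈ bihomog V (m + 1)
  rw [normSq_mul_mul_conj]
  exact sum_mem fun i _ => mul_conj_mem_bihomog (coord_mul_mem_homog i hf)
    (coord_mul_mem_homog i hg)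

theorem normSq_pow_mul_mem_bihomog {m : ℕ} (k : ℕ) {F : RealPoly V} (hF : F ∈ bihomog V m) :
    normSq V ^ k * F ∈ bihomog V (m + k) := by
  induction k with
  | zero => simpa using hF
  | succ k ih =>
    rw [pow_succ', mul_assoc]
    exact normSq_mul_mem_bihomog ih

/-- The Laplacian preserves sums of squares, as `Δ|f|² = ∑ |∂_i f|²`. -/
theorem laplace_mem_closure {F : RealPoly V}
    (hF : F ∈ AddSubmonoid.closure {F | ∃ f ∈ holPoly (V := V), f * f.conj = F}) :
    laplace F ∈ AddSubmonoid.closure {F | ∃ f ∈ holPoly (V := V), f * f.conj = F} := by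
  induction hF using AddSubmonoid.closure_induction with
  | mem F hF =>
    obtain ⟨f, hf, rfl⟩ := hF
    rw [laplace_mul_conj hf hf]
    exact sum_mem fun i _ => AddSubmonoid.subset_closure ⟨_, del_mem_holPoly hf _, rfl⟩
  | zero => rw [map_zero]; exact zero_mem _
  | add F G _ _ hF hG => rw [map_add]; exact add_mem hF hG

variable [MeasurableSpace V] [BorelSpace V]

theorem fischer_laplace_left (F G : RealPoly V) :
    fischer (laplace F) G = fischer F (normSq V * G) := by
  rw [laplace_apply, normSq_mul, fischer_sum_left, fischer_sum_right]
  refine Finset.sum_congr rfl fun i _ => ?_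
  rw [fischer_del_left, fischer_delBar_left, mul_left_comm]

theorem fischer_laplace_pow_left (k : ℕ) (F G : RealPoly V) :
    fischer ((laplace ^ k) F) G = fischer F (normSq V ^ k * G) := by
  induction k generalizing G with
  | zero => simp
  | succ k ih =>
    rw [pow_succ', Module.End.mul_apply, fischer_laplace_left, ih, pow_succ, mul_assoc]

/-- On polynomials of bidegree `(m, m)`, the Laplacian multiplies the Gaussian expectation
by `m`. -/
theorem fock_laplace_one {m : ℕ} {F : RealPoly V} (hF : F ∈ bihomog V m) :
    fock (laplace F) 1 = m * fock F 1 := by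
  induction hF using Submodule.span_induction with
  | mem F hF =>
    obtain ⟨f, hf, g, hg, rfl⟩ := hF
    rw [laplace_mul_conj (homog_le_holPoly _ hf) (homog_le_holPoly _ hg), fock_sum_left,
      fock_mul_conj, ← fock_smul_left, ← euler hf, fock_sum_left]
    refine Finset.sum_congr rfl fun i _ => ?_
    rw [fock_mul_conj, fock_coord_mul (del_mem_holPoly (homog_le_holPoly _ hf) _)]
  | zero => simp
  | add F G _ _ hF hG => rw [map_add, fock_add_left, hF, hG, fock_add_left, mul_add]
  | smul c F _ hF => rw [map_smul, fock_smul_left, hF, fock_smul_left, mul_left_comm]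

/-- On polynomials of bidegree `(m, m)`, multiplication by `⟨z, z⟩` multiplies the Gaussian
expectation by `n + m`. -/
theorem fock_normSq_mul_one {m : ℕ} {F : RealPoly V} (hF : F ∈ bihomog V m) :
    fock (normSq V * F) 1 = (finrank ℂ V + m) * fock F 1 := by
  induction hF using Submodule.span_induction with
  | mem F hF =>
    obtain ⟨f, hf, g, hg, rfl⟩ := hF
    rw [normSq_mul_mul_conj, fock_sum_left, fock_mul_conj]
    have h : ∀ i, fock ((coord (stdOrthonormalBasis ℂ V i) * f)
        * (coord (stdOrthonormalBasis ℂ V i) * g).conj) 1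
        = fock f g + fock (coord (stdOrthonormalBasis ℂ V i) * del (stdOrthonormalBasis ℂ V i) f)
          g := by
      intro i
      rw [fock_mul_conj, ← fock_del (homog_le_holPoly _ hg), Derivation.leibniz, del_coord,
        fock_add_left, add_comm]
      simp
    rw [Finset.sum_congr rfl fun i _ => h i, Finset.sum_add_distrib,
      ← fock_sum_left Finset.univ (fun i => coord (stdOrthonormalBasis ℂ V i) *
        del (stdOrthonormalBasis ℂ V i) f), euler hf, fock_smul_left]
    simp [add_mul]
  | zero => simp
  | add F G _ _ hF hG => rw [mul_add, fock_add_left, hF, hG, fock_add_left, mul_add]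
  | smul c F _ hF => rw [mul_smul_comm, fock_smul_left, hF, fock_smul_left, mul_left_comm]

theorem fischer_bihomog_of_ne {k l : ℕ} (hkl : k ≠ l) {F G : RealPoly V} (hF : F ∈ bihomog V k)
    (hG : G ∈ bihomog V l) : fischer F G = 0 := by
  induction hF using Submodule.span_induction with
  | mem F hF =>
    obtain ⟨f, hf, g, hg, rfl⟩ := hF
    induction hG using Submodule.span_induction with
    | mem G hG =>
      obtain ⟨h, hh, j, hj, rfl⟩ := hG
      rw [fischer_mul_conj (homog_le_holPoly _ hf) (homog_le_holPoly _ hg)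
        (homog_le_holPoly _ hh) (homog_le_holPoly _ hj), fock_homog_of_ne hkl hf hh, zero_mul]
    | zero => simp
    | add G H _ _ hG hH => rw [fischer_add_right, hG, hH, add_zero]
    | smul c G _ hG => rw [fischer_smul_right, hG, mul_zero]
  | zero => simp
  | add G H _ _ hG hH => rw [fischer_add_left, hG, hH, add_zero]
  | smul c G _ hG => rw [fischer_smul_left, hG, mul_zero]

/-- Sums of squares `|f|²` of holomorphic polynomials pair nonnegatively. -/
theorem fischer_nonneg {F G : RealPoly V}
    (hF : F ∈ AddSubmonoid.closure {F | ∃ f ∈ holPoly (V := V), f * f.conj = F})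
    (hG : G ∈ AddSubmonoid.closure {F | ∃ f ∈ holPoly (V := V), f * f.conj = F}) :
    ∃ x : ℝ, 0 ≤ x ∧ fischer F G = x := by
  induction hF using AddSubmonoid.closure_induction with
  | mem F hF =>
    obtain ⟨f, hf, rfl⟩ := hF
    induction hG using AddSubmonoid.closure_induction with
    | mem G hG =>
      obtain ⟨g, hg, rfl⟩ := hG
      refine ⟨‖fock f g‖ ^ 2, by positivity, ?_⟩
      rw [fischer_mul_conj hf hf hg hg, ← fock_conj_symm f g, RCLike.mul_conj]
      norm_cast
    | zero => exact ⟨0, le_rfl, by simp⟩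
    | add G H _ _ hG hH =>
      obtain ⟨x, hx, h1⟩ := hG
      obtain ⟨y, hy, h2⟩ := hH
      exact ⟨x + y, add_nonneg hx hy, by rw [fischer_add_right, h1, h2, Complex.ofReal_add]⟩
  | zero => exact ⟨0, le_rfl, by simp⟩
  | add G H _ _ hG hH =>
    obtain ⟨x, hx, h1⟩ := hG
    obtain ⟨y, hy, h2⟩ := hH
    exact ⟨x + y, add_nonneg hx hy, by rw [fischer_add_left, h1, h2, Complex.ofReal_add]⟩

end Bihomog

/-! ### The invariants -/

namespace MultFreeDecomposition

open RealPoly ComplexConjugate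

variable {V : Type*} [NormedAddCommGroup V] [InnerProductSpace ℂ V] [CompleteSpace V]
  {K : Subgroup (unitary (V →L[ℂ] V))} {Λ : Type*} (D : MultFreeDecomposition K Λ)
  [FiniteDimensional ℂ V] [MeasurableSpace V] [BorelSpace V]

theorem p_mem_bihomog (a : Λ) : D.p a ∈ bihomog V (D.deg a) := by
  rw [p_eq]
  exact Submodule.smul_mem _ _ (sum_mem fun j _ =>
    mul_conj_mem_bihomog (D.le_homog_deg a (D.onb_mem a j)) (D.le_homog_deg a (D.onb_mem a j)))

theorem fock_p_one (a : Λ) : fock (D.p a) 1 = 1 := by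
  rw [p_eq, fock_smul_left, fock_sum_left]
  simp [fock_mul_conj, fock_onb, D.dim_ne_zero]

theorem fischer_p_self {a : Λ} {h k : RealPoly V} (hh : h ∈ (D.P a).toSubmodule)
    (hk : k ∈ (D.P a).toSubmodule) :
    fischer (D.p a) (h * k.conj) = (D.dim a : ℂ)⁻¹ * fock k h := by
  rw [p_eq, fischer_smul_left, fischer_sum_left]
  conv_rhs => rw [← D.sum_fock_onb hk, fock_sum_left]
  congr 1
  refine Finset.sum_congr rfl fun j _ => ?_
  rw [fischer_mul_conj (D.le_holPoly a (D.onb_mem a j)) (D.le_holPoly a (D.onb_mem a j))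
    (D.le_holPoly a hh) (D.le_holPoly a hk), fock_smul_left, mul_comm]

theorem fischer_p_eq_zero {a b c : Λ} (h1 : ¬ (a = b ∧ a = c)) {h k : RealPoly V}
    (hh : h ∈ (D.P b).toSubmodule) (hk : k ∈ (D.P c).toSubmodule) :
    fischer (D.p a) (h * k.conj) = 0 := by
  rw [p_eq, fischer_smul_left, fischer_sum_left, Finset.sum_eq_zero, mul_zero]
  intro j _
  rw [fischer_mul_conj (D.le_holPoly a (D.onb_mem a j)) (D.le_holPoly a (D.onb_mem a j))
    (D.le_holPoly b hh) (D.le_holPoly c hk)]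
  by_cases hab : a = b
  · rw [D.fock_eq_zero (fun h => h1 ⟨hab, h.symm⟩) hk (D.onb_mem a j), mul_zero]
  · rw [D.fock_eq_zero hab (D.onb_mem a j) hh, zero_mul]

theorem fischer_p_p [DecidableEq Λ] (a b : Λ) :
    fischer (D.p a) (D.p b) = if a = b then (D.dim a : ℂ)⁻¹ else 0 := by
  rw [p_eq D b, fischer_smul_right, fischer_sum_right]
  split_ifs with hab
  · subst hab
    have := D.dim_ne_zero a
    simp only [D.fischer_p_self (D.onb_mem a _) (D.onb_mem a _), fock_onb, if_true]
    simp [this]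
  · simp [D.fischer_p_eq_zero (fun h => hab h.1) (D.onb_mem b _) (D.onb_mem b _)]

/-- A bihomogeneous polynomial is determined by its pairings with the products `h k̄` of elements of
the summands. -/
theorem eq_zero_of_fischer {m : ℕ} {F : RealPoly V} (hF : F ∈ bihomog V m)
    (h0 : ∀ b c, ∀ h ∈ (D.P b).toSubmodule, ∀ k ∈ (D.P c).toSubmodule,
      fischer F (h * k.conj) = 0) : F = 0 := by
  refine eq_zero_of_fischer_self ?_
  have h1 : ∀ c, ∀ k ∈ (D.P c).toSubmodule, ∀ h ∈ ⨆ b, (D.P b).toSubmodule,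
      fischer F (h * k.conj) = 0 := by
    intro c k hk h hh
    induction hh using Submodule.iSup_induction' with
    | mem b h hh => exact h0 b c h hh k hk
    | zero => simp
    | add x y _ _ hx hy => rw [add_mul, fischer_add_right, hx, hy, add_zero]
  have h2 : ∀ h ∈ ⨆ b, (D.P b).toSubmodule, ∀ k ∈ ⨆ b, (D.P b).toSubmodule,
      fischer F (h * k.conj) = 0 := by
    intro h hh k hk
    induction hk using Submodule.iSup_induction' with
    | mem c k hk => exact h1 c k hk h hh
    | zero => simp
    | add x y _ _ hx hy => rw [RealPoly.conj_add, mul_add, fischer_add_right, hx, hy, add_zero]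
  rw [D.iSup_eq] at h2
  suffices ∀ G ∈ bihomog V m, fischer F G = 0 from this F hF
  intro G hG
  induction hG using Submodule.span_induction with
  | mem G hG =>
    obtain ⟨h, hh, k, hk, rfl⟩ := hG
    exact h2 h (homog_le_holPoly _ hh) k (homog_le_holPoly _ hk)
  | zero => simp
  | add G H _ _ hG hH => rw [fischer_add_right, hG, hH, add_zero]
  | smul c G _ hG => rw [fischer_smul_right, hG, mul_zero]

theorem polyRep_p (k : K) (a : Λ) : polyRep K k (D.p a) = D.p a := by
  rw [← sub_eq_zero]
  refine D.eq_zero_of_fischer (sub_mem (polyRep_mem_bihomog k (D.p_mem_bihomog a))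
    (D.p_mem_bihomog a)) fun b c h hh j hj => ?_
  rw [sub_eq_add_neg, ← neg_one_smul ℂ, fischer_add_left, fischer_smul_left, neg_one_mul,
    ← sub_eq_add_neg, sub_eq_zero]
  have h1 : fischer (polyRep K k (D.p a)) (h * j.conj)
      = fischer (D.p a) (polyRep K k⁻¹ h * (polyRep K k⁻¹ j).conj) := by
    rw [← fischer_polyRep k (D.p a), polyRep_mul, polyRep_conj, polyRep_inv_self, polyRep_inv_self]
  have hh' := (D.P b).apply_mem_toSubmodule k⁻¹ hh
  have hj' := (D.P c).apply_mem_toSubmodule k⁻¹ hj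
  rw [h1]
  by_cases habc : a = b ∧ a = c
  · obtain ⟨rfl, rfl⟩ := habc
    rw [D.fischer_p_self hh' hj', D.fischer_p_self hh hj, fock_polyRep]
  · rw [D.fischer_p_eq_zero habc hh' hj', D.fischer_p_eq_zero habc hh hj]

/-- The sesquilinear form `(k, h) ↦ ⟨F, h k̄⟩` attached to a polynomial function. -/
def symbolForm (F : RealPoly V) : RealPoly V →ₗ[ℂ] RealPoly V →ₗ⋆[ℂ] ℂ :=
  LinearMap.mk₂'ₛₗ (RingHom.id ℂ) (starRingEnd ℂ) (fun k h => fischer F (h * k.conj))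
    (fun x y z => by rw [conj_add, mul_add, fischer_add_right])
    (fun c x y => by rw [conj_smul, mul_smul_comm, fischer_smul_right, Complex.conj_conj]; rfl)
    (fun x y z => by rw [add_mul, fischer_add_right])
    (fun c x y => by rw [smul_mul_assoc, fischer_smul_right]; rfl)

/-- The `K`-invariant polynomials of bidegree `(m, m)` are spanned by the `p_b` with
`|b| = m`. -/
theorem eq_sum_p {m : ℕ} {F : RealPoly V} (hF : F ∈ bihomog V m)
    (hinv : ∀ k : K, polyRep K k F = F) :
    F = ∑ b ∈ D.level m, (D.dim b * fischer F (D.p b)) • D.p b := by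
  classical
  rw [← sub_eq_zero]
  refine D.eq_zero_of_fischer (sub_mem hF (sum_mem fun b hb => Submodule.smul_mem _ _ ?_))
    fun b c h hh k hk => ?_
  · have := D.p_mem_bihomog b
    rwa [D.mem_level.1 hb] at this
  rw [sub_eq_add_neg, ← neg_one_smul ℂ, fischer_add_left, fischer_smul_left, neg_one_mul,
    ← sub_eq_add_neg, sub_eq_zero, fischer_sum_left]
  have hB : ∀ k : K, ∀ x y, symbolForm F (polyRep K k x) (polyRep K k y) = symbolForm F x y := by
    intro k x y
    change fischer F (polyRep K k y * (polyRep K k x).conj) = fischer F (y * x.conj)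
    rw [← polyRep_conj, ← polyRep_mul]
    conv_lhs => rw [← hinv k]
    exact fischer_polyRep k F _
  by_cases hbc : b = c
  · subst hbc
    by_cases hb : D.deg b = m
    · obtain ⟨s, hs⟩ := D.exists_form_eq_mul b (symbolForm F) hB
      replace hs : ∀ x ∈ (D.P b).toSubmodule, ∀ y ∈ (D.P b).toSubmodule,
        fischer F (y * x.conj) = s * fock x y := hs
      have hd := D.dim_ne_zero b
      have hFp : fischer F (D.p b) = s := by
        rw [p_eq, fischer_smul_right, fischer_sum_right]
        simp only [hs _ (D.onb_mem b _) _ (D.onb_mem b _), fock_onb, if_true]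
        simp [hd]
      rw [Finset.sum_eq_single b, fischer_smul_left, D.fischer_p_self hh hk, hFp, hs k hk h hh]
      · field_simp
      · intro a _ hab
        rw [fischer_smul_left, D.fischer_p_eq_zero (fun h => hab h.1) hh hk, mul_zero]
      · intro h
        exact absurd (D.mem_level.2 hb) h
    · rw [fischer_bihomog_of_ne (Ne.symm hb) hF (mul_conj_mem_bihomog (D.le_homog_deg b hh)
        (D.le_homog_deg b hk)), Finset.sum_eq_zero]
      intro a ha
      rw [fischer_smul_left, D.fischer_p_eq_zero _ hh hk, mul_zero]
      rintro ⟨rfl, -⟩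
      exact hb (D.mem_level.1 ha)
  · have h1 : fischer F (h * k.conj) = 0 :=
      D.form_eq_zero (Ne.symm hbc) (symbolForm F) hB hk hh
    rw [h1, Finset.sum_eq_zero]
    intro a ha
    rw [fischer_smul_left, D.fischer_p_eq_zero _ hh hk, mul_zero]
    rintro ⟨rfl, rfl⟩
    exact hbc rfl

end MultFreeDecomposition

/-! ### The generalized binomial coefficients -/

section Evaluation

open RealPoly

variable {V : Type*} [NormedAddCommGroup V] [InnerProductSpace ℂ V] [FiniteDimensional ℂ V]

theorem bihomog_apply_zero {m : ℕ} {F : RealPoly V} (hF : F ∈ bihomog V (m + 1)) :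
    F (0 : V) = 0 := by
  induction hF using Submodule.span_induction with
  | mem F hF =>
    obtain ⟨f, hf, g, hg, rfl⟩ := hF
    have h := (homog_le_homogPoly hf).2 0 0
    rw [zero_smul, zero_pow (Nat.succ_ne_zero m), zero_mul] at h
    rw [RealPoly.mul_apply, h, zero_mul]
  | zero => rfl
  | add F G _ _ hF hG => rw [RealPoly.add_apply, hF, hG, add_zero]
  | smul c F _ hF => rw [RealPoly.smul_apply, hF, mul_zero]

variable [MeasurableSpace V] [BorelSpace V]

theorem fock_laplace_pow_one {m : ℕ} (k : ℕ) {F : RealPoly V} (hF : F ∈ bihomog V (m + k)) :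
    fock ((laplace ^ k) F) 1 * m.factorial = (m + k).factorial * fock F 1 := by
  induction k generalizing F with
  | zero => simp [mul_comm]
  | succ k ih =>
    rw [pow_succ, Module.End.mul_apply, ih (laplace_mem_bihomog hF), fock_laplace_one hF,
      ← add_assoc, Nat.factorial_succ]
    push_cast
    ring

theorem fock_normSq_pow_mul_one {m : ℕ} (k : ℕ) {F : RealPoly V} (hF : F ∈ bihomog V m) :
    fock (normSq V ^ k * F) 1 = (finrank ℂ V + m).ascFactorial k * fock F 1 := by
  induction k with
  | zero => simp
  | succ k ih =>
    rw [pow_succ', mul_assoc, fock_normSq_mul_one (normSq_pow_mul_mem_bihomog k hF), ih,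
      Nat.ascFactorial_succ]
    push_cast
    ring

end Evaluation

namespace MultFreeDecomposition

open RealPoly ComplexConjugate

variable {V : Type*} [NormedAddCommGroup V] [InnerProductSpace ℂ V] [CompleteSpace V]
  {K : Subgroup (unitary (V →L[ℂ] V))} {Λ : Type*} (D : MultFreeDecomposition K Λ)
  [FiniteDimensional ℂ V] [MeasurableSpace V] [BorelSpace V]

theorem laplace_pow_p_mem {a : Λ} {k : ℕ} (hk : k ≤ D.deg a) :
    (laplace ^ k) (D.p a) ∈ bihomog V (D.deg a - k) :=
  laplace_pow_mem_bihomog k (by rw [Nat.sub_add_cancel hk]; exact D.p_mem_bihomog a)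

theorem laplace_pow_p {a : Λ} {k : ℕ} (hk : k ≤ D.deg a) : (laplace ^ k) (D.p a) =
    ∑ b ∈ D.level (D.deg a - k), (D.dim b * fischer ((laplace ^ k) (D.p a)) (D.p b)) • D.p b := by
  refine D.eq_sum_p (D.laplace_pow_p_mem hk) fun g => ?_
  have h : ∀ k F, polyRep K g ((laplace ^ k) F) = (laplace ^ k) (polyRep K g F) := by
    intro k
    induction k with
    | zero => intro F; rfl
    | succ k ih =>
      intro F
      rw [pow_succ, Module.End.mul_apply, ih, Module.End.mul_apply, laplace_polyRep]
  rw [h, D.polyRep_p]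

theorem normSq_pow_mul_p (a : Λ) (k : ℕ) : normSq V ^ k * D.p a =
    ∑ b ∈ D.level (D.deg a + k), (D.dim b * fischer (normSq V ^ k * D.p a) (D.p b)) • D.p b := by
  refine D.eq_sum_p (normSq_pow_mul_mem_bihomog k (D.p_mem_bihomog a)) fun g => ?_
  rw [polyRep_mul, D.polyRep_p]
  congr 1
  induction k with
  | zero => rfl
  | succ k ih => rw [pow_succ, polyRep_mul, ih, polyRep_normSq]

theorem heat_p (a : Λ) : heat (D.p a) =
    ∑ k ∈ Finset.range (D.deg a + 1), ((-1) ^ k / k.factorial : ℂ) • (laplace ^ k) (D.p a) :=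
  heat_eq_sum fun _ hk => laplace_pow_eq_zero hk (D.p_mem_bihomog a)

theorem heat_p_apply_zero (a : Λ) : heat (D.p a) (0 : V) = (-1) ^ D.deg a := by
  have hm := D.laplace_pow_p_mem (a := a) le_rfl
  rw [Nat.sub_self] at hm
  obtain ⟨c, hc⟩ := mem_bihomog_zero hm
  have h := fock_laplace_pow_one (m := 0) (D.deg a) (by rw [zero_add]; exact D.p_mem_bihomog a)
  rw [hc, Algebra.algebraMap_eq_smul_one, fock_smul_left, fock_one_one, D.fock_p_one,
    zero_add, Nat.factorial_zero, Nat.cast_one, mul_one, mul_one, mul_one] at h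
  rw [heat_p, RealPoly.sum_apply, Finset.sum_range_succ, Finset.sum_eq_zero, zero_add,
    RealPoly.smul_apply, hc, h, RealPoly.algebraMap_apply,
    div_mul_cancel₀ _ (Nat.cast_ne_zero.2 (Nat.factorial_ne_zero _))]
  intro k hk
  have hk' := Finset.mem_range.1 hk
  have hmem := D.laplace_pow_p_mem hk'.le
  obtain ⟨j, hj⟩ : ∃ j, D.deg a - k = j + 1 := ⟨D.deg a - k - 1, by omega⟩
  rw [hj] at hmem
  rw [RealPoly.smul_apply, bihomog_apply_zero hmem, mul_zero]

theorem p_mem_closure (a : Λ) :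
    ∃ F ∈ AddSubmonoid.closure {F | ∃ f ∈ holPoly (V := V), f * f.conj = F},
      D.p a = (D.dim a : ℂ)⁻¹ • F :=
  ⟨_, sum_mem fun j _ => AddSubmonoid.subset_closure ⟨_, D.le_holPoly a (D.onb_mem a j), rfl⟩,
    D.p_eq a⟩

theorem fischer_laplace_pow_p_nonneg (a b : Λ) (k : ℕ) :
    ∃ x : ℝ, 0 ≤ x ∧ fischer ((laplace ^ k) (D.p a)) (D.p b) = x := by
  obtain ⟨F, hF, hFa⟩ := D.p_mem_closure a
  obtain ⟨G, hG, hGb⟩ := D.p_mem_closure b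
  have hF' : (laplace ^ k) F ∈
      AddSubmonoid.closure {F | ∃ f ∈ holPoly (V := V), f * f.conj = F} := by
    induction k with
    | zero => exact hF
    | succ k ih => rw [pow_succ', Module.End.mul_apply]; exact laplace_mem_closure ih
  obtain ⟨x, hx, hFG⟩ := fischer_nonneg hF' hG
  refine ⟨(D.dim a : ℝ)⁻¹ * ((D.dim b : ℝ)⁻¹ * x), by positivity, ?_⟩
  rw [hFa, hGb, map_smul, fischer_smul_left, fischer_smul_right, hFG]
  simp

variable [LinearOrder Λ]

/-- `e^{-Δ} p_a` differs from `p_a` by a combination of preceding `p_b`. -/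
theorem p_sub_heat_p_mem (hord : ∀ a b : Λ, D.deg a < D.deg b → a < b) (a : Λ) :
    D.p a - heat (D.p a) ∈ Submodule.span ℂ (D.p '' Set.Iio a) := by
  rw [heat_p, Finset.sum_range_succ']
  simp only [pow_zero, Nat.factorial_zero, Nat.cast_one, div_one, one_smul, Module.End.one_apply]
  rw [sub_add_cancel_right]
  refine Submodule.neg_mem _ (sum_mem fun k hk => Submodule.smul_mem _ _ ?_)
  have hk' := Finset.mem_range.1 hk
  rw [D.laplace_pow_p (Nat.succ_le_of_lt hk')]
  refine sum_mem fun b hb => Submodule.smul_mem _ _ (Submodule.subset_span ⟨b, ?_, rfl⟩)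
  have := D.mem_level.1 hb
  exact hord b a (by omega)

variable [WellFoundedLT Λ]

theorem fock_heat_p_p (hord : ∀ a b : Λ, D.deg a < D.deg b → a < b) {a b : Λ} (hab : b < a) :
    fock (heat (D.p a)) (D.p b) = 0 := by
  induction b using WellFoundedLT.induction with
  | _ b ih =>
  have h1 : fock (heat (D.p a)) (heat (D.p b)) = 0 :=
    (D.fischer_p_p a b).trans (if_neg hab.ne')
  have h2 : ∀ x ∈ Submodule.span ℂ (D.p '' Set.Iio b), fock (heat (D.p a)) x = 0 := by
    intro x hx
    induction hx using Submodule.span_induction with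
    | mem x hx =>
      obtain ⟨c, hc, rfl⟩ := hx
      exact ih c hc (lt_trans hc hab)
    | zero => simp
    | add x y _ _ hx hy => rw [fock_add_right, hx, hy, add_zero]
    | smul c x _ hx => rw [fock_smul_right, hx, mul_zero]
  rw [← sub_add_cancel (D.p b) (heat (D.p b)), fock_add_right, h1, add_zero]
  exact h2 _ (D.p_sub_heat_p_mem hord b)

variable [LocallyFiniteOrderBot Λ]

/-- `e^{-Δ} p_a` differs from `p_a` by a combination of earlier `p_b` and is Fock orthogonal to all
of them, which characterizes the result of the Gram-Schmidt process. -/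
theorem gramSchmidt_p (hord : ∀ a b : Λ, D.deg a < D.deg b → a < b) (a : Λ) :
    InnerProductSpace.gramSchmidt ℂ D.p a = heat (D.p a) := by
  set g := InnerProductSpace.gramSchmidt ℂ D.p a with hg
  have h1 : D.p a - g ∈ Submodule.span ℂ (D.p '' Set.Iio a) := by
    rw [← InnerProductSpace.span_gramSchmidt_Iio ℂ D.p a,
      InnerProductSpace.gramSchmidt_def' ℂ D.p a, ← hg, add_sub_cancel_left]
    refine sum_mem fun b hb => ?_
    rw [Submodule.starProjection_singleton]
    exact Submodule.smul_mem _ _ (Submodule.subset_span ⟨b, Finset.mem_Iio.1 hb, rfl⟩)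
  have h2 : g - heat (D.p a) ∈ Submodule.span ℂ (D.p '' Set.Iio a) := by
    have := sub_mem (D.p_sub_heat_p_mem hord a) h1
    rwa [sub_sub_sub_cancel_left] at this
  have h3 : ∀ x ∈ Submodule.span ℂ (D.p '' Set.Iio a), fock (g - heat (D.p a)) x = 0 := by
    intro x hx
    induction hx using Submodule.span_induction with
    | mem x hx =>
      obtain ⟨b, hb, rfl⟩ := hx
      have h4 : fock g (D.p b) = 0 := by
        rw [← fock_conj_symm, map_eq_zero]
        exact InnerProductSpace.gramSchmidt_inv_triangular ℂ D.p hb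
      rw [fock_sub_left, h4, D.fock_heat_p_p hord hb, sub_zero]
    | zero => simp
    | add x y _ _ hx hy => rw [fock_add_right, hx, hy, add_zero]
    | smul c x _ hx => rw [fock_smul_right, hx, mul_zero]
  exact sub_eq_zero.1 (eq_zero_of_fock_self (h3 _ h2))

theorem q_eq (hord : ∀ a b : Λ, D.deg a < D.deg b → a < b) (a : Λ) :
    D.q a = (-1 : ℂ) ^ D.deg a • heat (D.p a) := by
  rw [q, D.gramSchmidt_p hord, heat_p_apply_zero, ← inv_pow, inv_neg_one]

theorem coeff_eq (a b : Λ) : D.coeff a b = D.dim b * fischer (D.q a) (D.p b) := by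
  have h := (D.exists_expansion a).choose_spec.2
  change D.q a = (D.coeff a).sum fun b x => x • D.p b at h
  rw [h, Finsupp.sum, fischer_sum_left]
  simp only [fischer_smul_left, fischer_p_p]
  have hd := D.dim_ne_zero b
  by_cases hb : D.coeff a b = 0
  · simp [hb]
  · simp only [mul_ite, mul_zero, Finset.sum_ite_eq', Finsupp.mem_support_iff, ne_eq, hb,
      not_false_eq_true, if_true]
    field_simp

/-- The generalized binomial coefficients are the coefficients of `Δ^k p_a / k!`. -/
theorem binom_eq (hord : ∀ a b : Λ, D.deg a < D.deg b → a < b) {a b : Λ} {k : ℕ}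
    (hk : D.deg a = D.deg b + k) :
    (k.factorial * D.binom a b : ℂ) = D.dim b * fischer ((laplace ^ k) (D.p a)) (D.p b) := by
  have hf : (k.factorial : ℂ) ≠ 0 := Nat.cast_ne_zero.2 k.factorial_ne_zero
  have h1 : fischer (D.q a) (D.p b) =
      (-1) ^ D.deg b * (fischer ((laplace ^ k) (D.p a)) (D.p b) / k.factorial) := by
    rw [D.q_eq hord, fischer_smul_left, heat_p, fischer_sum_left, Finset.sum_eq_single k,
      fischer_smul_left, hk, pow_add]
    · have : (-1 : ℂ) ^ k * (-1) ^ k = 1 := by rw [← mul_pow]; simp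
      linear_combination ((-1) ^ D.deg b * (fischer ((laplace ^ k) (D.p a)) (D.p b)
        / k.factorial)) * this
    · intro j hj hjk
      have hj' := Finset.mem_range.1 hj
      rw [fischer_smul_left, fischer_bihomog_of_ne _ (D.laplace_pow_p_mem (by omega))
        (D.p_mem_bihomog b), mul_zero]
      omega
    · intro h
      exact absurd (Finset.mem_range.2 (by omega)) h
  obtain ⟨x, -, hx⟩ := D.fischer_laplace_pow_p_nonneg a b k
  have h2 : D.coeff a b = ((D.dim b * ((-1) ^ D.deg b * (x / k.factorial)) : ℝ) : ℂ) := by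
    rw [D.coeff_eq, h1, hx]
    push_cast
    rfl
  have h3 : D.binom a b = D.dim b * (x / k.factorial) := by
    rw [binom, if_pos (by omega), h2, Complex.ofReal_re]
    have : (-1 : ℝ) ^ D.deg b * (-1) ^ D.deg b = 1 := by rw [← mul_pow]; simp
    linear_combination (D.dim b * (x / k.factorial)) * this
  rw [h3, hx]
  push_cast
  field_simp

theorem binom_of_deg_lt {a b : Λ} (h : D.deg a < D.deg b) : D.binom a b = 0 :=
  if_neg (not_le.2 h)

theorem binom_nonneg (hord : ∀ a b : Λ, D.deg a < D.deg b → a < b) (a b : Λ) :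
    0 ≤ D.binom a b := by
  rcases lt_or_ge (D.deg a) (D.deg b) with h | h
  · exact (D.binom_of_deg_lt h).ge
  obtain ⟨k, hk⟩ := Nat.exists_eq_add_of_le h
  obtain ⟨x, hx, h1⟩ := D.fischer_laplace_pow_p_nonneg a b k
  have h2 := D.binom_eq hord hk
  rw [h1] at h2
  have h3 : (k.factorial : ℝ) * D.binom a b = D.dim b * x := by exact_mod_cast h2
  have h4 : (0 : ℝ) < k.factorial := Nat.cast_pos.2 k.factorial_pos
  exact nonneg_of_mul_nonneg_right (h3 ▸ by positivity) h4

theorem binom_of_deg_eq (hord : ∀ a b : Λ, D.deg a < D.deg b → a < b) {a b : Λ}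
    (h : D.deg a = D.deg b) : D.binom a b = if a = b then 1 else 0 := by
  have h1 := D.binom_eq hord (k := 0) h
  have hd := D.dim_ne_zero b
  rw [pow_zero, Module.End.one_apply, fischer_p_p, Nat.factorial_zero, Nat.cast_one, one_mul] at h1
  split_ifs at h1 ⊢ with hab
  · subst hab
    rw [mul_inv_cancel₀ hd] at h1
    exact_mod_cast h1
  · rw [mul_zero] at h1
    exact_mod_cast h1

theorem laplace_pow_p_eq (hord : ∀ a b : Λ, D.deg a < D.deg b → a < b) {a : Λ} {m k : ℕ}
    (hk : D.deg a = m + k) : (laplace ^ k) (D.p a) =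
      ∑ b ∈ D.level m, (k.factorial * D.binom a b : ℂ) • D.p b := by
  rw [D.laplace_pow_p (by omega), hk, Nat.add_sub_cancel]
  refine Finset.sum_congr rfl fun b hb => ?_
  rw [D.binom_eq hord (by rw [hk, D.mem_level.1 hb])]

/-- Multiplication by `⟨z, z⟩` is adjoint to `Δ`, so its powers expand with the transposed
coefficients. -/
theorem normSq_pow_mul_p_eq (hord : ∀ a b : Λ, D.deg a < D.deg b → a < b) (a : Λ) (k : ℕ) :
    normSq V ^ k * D.p a = ∑ b ∈ D.level (D.deg a + k),
      (k.factorial * ((D.dim b : ℂ) / D.dim a * D.binom b a)) • D.p b := by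
  rw [D.normSq_pow_mul_p a]
  refine Finset.sum_congr rfl fun b hb => ?_
  have h := D.binom_eq hord (D.mem_level.1 hb)
  obtain ⟨x, -, hx⟩ := D.fischer_laplace_pow_p_nonneg b a k
  rw [hx] at h
  rw [← fischer_conj_symm, ← fischer_laplace_pow_left, hx, Complex.conj_ofReal]
  have hd := D.dim_ne_zero a
  congr 1
  field_simp
  linear_combination -(D.dim b : ℂ) * h

/-- The chain rule for the binomial coefficients, from `Δ^j Δ^k = Δ^(j + k)`; it becomes the
semigroup property of both chains. -/
theorem sum_binom_mul_binom (hord : ∀ a b : Λ, D.deg a < D.deg b → a < b) {a b : Λ} {j k : ℕ}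
    (h : D.deg a = D.deg b + j + k) : ∑ u ∈ D.level (D.deg b + j), D.binom a u * D.binom u b =
      (j + k).choose j * D.binom a b := by
  have h1 := D.binom_eq hord (a := a) (b := b) (k := j + k) (by omega)
  rw [pow_add, Module.End.mul_apply, D.laplace_pow_p_eq hord h, map_sum, fischer_sum_left,
    Finset.mul_sum] at h1
  have h2 : ∀ u ∈ D.level (D.deg b + j), (D.dim b : ℂ) * fischer ((laplace ^ j)
      ((k.factorial * D.binom a u : ℂ) • D.p u)) (D.p b)
      = (j.factorial * k.factorial : ℂ) * (D.binom a u * D.binom u b) := by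
    intro u hu
    rw [map_smul, fischer_smul_left]
    linear_combination -(k.factorial * D.binom a u : ℂ) * D.binom_eq hord (D.mem_level.1 hu)
  rw [Finset.sum_congr rfl h2, ← Finset.mul_sum, ← Nat.add_choose_mul_factorial_mul_factorial] at h1
  have hj : (j.factorial * k.factorial : ℂ) ≠ 0 := by
    exact_mod_cast mul_ne_zero j.factorial_ne_zero k.factorial_ne_zero
  have h3 : ((∑ u ∈ D.level (D.deg b + j), D.binom a u * D.binom u b : ℝ) : ℂ) =
      ((((j + k).choose j : ℝ) * D.binom a b : ℝ) : ℂ) := by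
    refine mul_left_cancel₀ hj ?_
    push_cast at h1 ⊢
    rw [Nat.choose_symm_add]
    linear_combination -h1
  exact_mod_cast h3

/-- The row sums of the death chain, from the Gaussian expectation of `Δ^k p_a`. -/
theorem sum_binom (hord : ∀ a b : Λ, D.deg a < D.deg b → a < b) {a : Λ} {m k : ℕ}
    (h : D.deg a = m + k) : ∑ b ∈ D.level m, D.binom a b = (m + k).choose m := by
  have h1 := fock_laplace_pow_one (m := m) k (F := D.p a) (h ▸ D.p_mem_bihomog a)
  rw [D.laplace_pow_p_eq hord h, fock_sum_left, D.fock_p_one] at h1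
  simp only [fock_smul_left, D.fock_p_one, mul_one] at h1
  rw [← Finset.mul_sum, ← Nat.add_choose_mul_factorial_mul_factorial] at h1
  have hj : (m.factorial * k.factorial : ℂ) ≠ 0 := by
    exact_mod_cast mul_ne_zero m.factorial_ne_zero k.factorial_ne_zero
  have h3 : ((∑ b ∈ D.level m, D.binom a b : ℝ) : ℂ) = (((m + k).choose m : ℝ) : ℂ) := by
    refine mul_left_cancel₀ hj ?_
    push_cast at h1 ⊢
    rw [Nat.choose_symm_add]
    linear_combination h1
  exact_mod_cast h3

/-- The row sums of the birth chain, from the Gaussian expectation of `⟨z, z⟩^k p_a`. -/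
theorem sum_dim_mul_binom (hord : ∀ a b : Λ, D.deg a < D.deg b → a < b) (a : Λ) (k : ℕ) :
    ∑ b ∈ D.level (D.deg a + k), (D.dim b : ℝ) / D.dim a * D.binom b a =
      (finrank ℂ V + D.deg a + k - 1).choose k := by
  have h1 := fock_normSq_pow_mul_one k (D.p_mem_bihomog a)
  rw [D.normSq_pow_mul_p_eq hord, fock_sum_left, D.fock_p_one] at h1
  simp only [fock_smul_left, D.fock_p_one, mul_one] at h1
  rw [← Finset.mul_sum, Nat.ascFactorial_eq_factorial_mul_choose'] at h1
  push_cast at h1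
  have h2 := mul_left_cancel₀ (Nat.cast_ne_zero.2 k.factorial_ne_zero) h1
  apply Complex.ofReal_injective
  push_cast
  exact h2

end MultFreeDecomposition

/-! ### The birth and death semigroups -/

section Calculus

/-- The derivative at `0` of the time dependence of the transition probabilities. -/
theorem hasDerivAt_exp_pow_mul (c : ℝ) (m k : ℕ) :
    HasDerivAt (fun t : ℝ => c * (Real.exp (-t) ^ m * (1 - Real.exp (-t)) ^ k))
      (c * if k = 0 then -(m : ℝ) else if k = 1 then 1 else 0) 0 := by
  have h1 : HasDerivAt (fun t : ℝ => Real.exp (-t)) (-1) 0 := by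
    simpa using (hasDerivAt_neg (0 : ℝ)).exp
  have h2 := ((h1.pow m).mul ((h1.const_sub 1).pow k)).const_mul c
  refine h2.congr_deriv ?_
  rcases k with _ | _ | k <;> simp

/-- The negative binomial distribution has total mass `1`. -/
theorem hasSum_negBinomial (N : ℕ) {x : ℝ} (hx : 0 < x) (hx1 : x ≤ 1) :
    HasSum (fun k : ℕ => ((N + k - 1).choose k : ℝ) * (1 - x) ^ k * x ^ N) 1 := by
  rcases N with _ | N
  · have h := hasSum_single (f := fun k : ℕ => ((0 + k - 1).choose k : ℝ) * (1 - x) ^ k * x ^ 0) 0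
      fun k hk => by
        rw [Nat.choose_eq_zero_of_lt (by omega)]
        simp
    simpa using h
  · have h := (hasSum_choose_mul_geometric_of_norm_lt_one N (r := 1 - x)
      (by rw [Real.norm_eq_abs, abs_of_nonneg (by linarith)]; linarith)).mul_right (x ^ (N + 1))
    rw [sub_sub_cancel, one_div, inv_mul_cancel₀ (pow_pos hx _).ne'] at h
    refine h.congr_fun fun k => ?_
    rw [show N + 1 + k - 1 = N + k by omega, ← Nat.choose_symm_add, add_comm N k]

end Calculus

namespace MultFreeDecomposition

variable {V : Type*} [NormedAddCommGroup V] [InnerProductSpace ℂ V] [CompleteSpace V]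
  {K : Subgroup (unitary (V →L[ℂ] V))} {Λ : Type*} (D : MultFreeDecomposition K Λ)
  [FiniteDimensional ℂ V] [MeasurableSpace V] [BorelSpace V]
  [LinearOrder Λ]

/-- The summands whose degree lies between `m` and `n`. -/
def between (m n : ℕ) : Finset Λ := (Finset.Ico m (n + 1)).biUnion D.level

theorem mem_between {m n : ℕ} {u : Λ} : u ∈ D.between m n ↔ m ≤ D.deg u ∧ D.deg u ≤ n := by
  simp [between, mem_level]

theorem sum_between (m N : ℕ) (f : Λ → ℝ) :
    ∑ u ∈ D.between m (m + N), f u = ∑ j ∈ Finset.range (N + 1), ∑ u ∈ D.level (m + j), f u := by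
  rw [between, Finset.sum_biUnion, Finset.sum_Ico_eq_sum_range]
  · congr 2
    omega
  · intro i _ j _ hij
    rw [Function.onFun, Finset.disjoint_left]
    intro u hu hu'
    exact hij ((D.mem_level.1 hu).symm.trans (D.mem_level.1 hu'))

variable [LocallyFiniteOrderBot Λ] [WellFoundedLT Λ]

theorem deathFormula_of_lt {a b : Λ} (h : D.deg a < D.deg b) (t : ℝ) : D.deathFormula t a b = 0 :=
  if_neg (not_le.2 h)

theorem birthFormula_of_lt {a b : Λ} (h : D.deg b < D.deg a) (t : ℝ) : D.birthFormula t a b = 0 :=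
  if_neg (not_le.2 h)

theorem deathFormula_eq {a b : Λ} {k : ℕ} (h : D.deg a = D.deg b + k) (t : ℝ) :
    D.deathFormula t a b = D.binom a b * (Real.exp (-t) ^ D.deg b * (1 - Real.exp (-t)) ^ k) := by
  rw [deathFormula, if_pos (by omega), ← Real.exp_nat_mul, h, Nat.add_sub_cancel_left, mul_assoc,
    neg_mul, mul_neg]

theorem birthFormula_eq {a b : Λ} {k : ℕ} (h : D.deg b = D.deg a + k) (t : ℝ) :
    D.birthFormula t a b = (D.dim b : ℝ) / D.dim a * D.binom b a *
      (Real.exp (-t) ^ (finrank ℂ V + D.deg a) * (1 - Real.exp (-t)) ^ k) := by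
  rw [birthFormula, if_pos (by omega), h, Nat.add_sub_cancel_left, add_comm (finrank ℂ V)]
  ring

theorem deathFormula_semigroup (hord : ∀ a b : Λ, D.deg a < D.deg b → a < b) (s t : ℝ) (a b : Λ) :
    D.deathFormula (s + t) a b =
      ∑ u ∈ D.between (D.deg b) (D.deg a), D.deathFormula s a u * D.deathFormula t u b := by
  rcases lt_or_ge (D.deg a) (D.deg b) with h | h
  · rw [D.deathFormula_of_lt h, Finset.sum_eq_zero]
    intro u hu
    have := D.mem_between.1 hu
    omega
  obtain ⟨N, hN⟩ := Nat.exists_eq_add_of_le h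
  rw [hN, D.sum_between, D.deathFormula_eq hN, neg_add, Real.exp_add]
  set x := Real.exp (-s)
  set y := Real.exp (-t)
  have h1 : ∀ j ∈ Finset.range (N + 1), ∑ u ∈ D.level (D.deg b + j),
      D.deathFormula s a u * D.deathFormula t u b =
      D.binom a b * (x * y) ^ D.deg b *
        ((x * (1 - y)) ^ j * (1 - x) ^ (N - j) * (N.choose j)) := by
    intro j hj
    have hj' : j ≤ N := Nat.lt_succ_iff.1 (Finset.mem_range.1 hj)
    obtain ⟨k, rfl⟩ := Nat.exists_eq_add_of_le hj'
    have h2 : ∀ u ∈ D.level (D.deg b + j), D.deathFormula s a u * D.deathFormula t u b =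
        (D.binom a u * D.binom u b) * (x ^ (D.deg b + j) * (1 - x) ^ k * y ^ D.deg b
          * (1 - y) ^ j) := by
      intro u hu
      have hu := D.mem_level.1 hu
      rw [D.deathFormula_eq (a := a) (b := u) (k := k) (by omega), D.deathFormula_eq hu, hu]
      ring
    rw [Finset.sum_congr rfl h2, ← Finset.sum_mul,
      D.sum_binom_mul_binom hord (k := k) (by omega), Nat.add_sub_cancel_left]
    simp only [mul_pow]
    ring
  rw [Finset.sum_congr rfl h1, ← Finset.mul_sum, ← add_pow]
  ring

theorem birthFormula_semigroup (hord : ∀ a b : Λ, D.deg a < D.deg b → a < b) (s t : ℝ) (a b : Λ) :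
    D.birthFormula (s + t) a b =
      ∑ u ∈ D.between (D.deg a) (D.deg b), D.birthFormula s a u * D.birthFormula t u b := by
  rcases lt_or_ge (D.deg b) (D.deg a) with h | h
  · rw [D.birthFormula_of_lt h, Finset.sum_eq_zero]
    intro u hu
    have := D.mem_between.1 hu
    omega
  obtain ⟨N, hN⟩ := Nat.exists_eq_add_of_le h
  rw [hN, D.sum_between, D.birthFormula_eq hN, neg_add, Real.exp_add]
  set x := Real.exp (-s)
  set y := Real.exp (-t)
  have h1 : ∀ j ∈ Finset.range (N + 1), ∑ u ∈ D.level (D.deg a + j),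
      D.birthFormula s a u * D.birthFormula t u b =
      (D.dim b : ℝ) / D.dim a * D.binom b a * (x * y) ^ (finrank ℂ V + D.deg a) *
        (((1 - x) * y) ^ j * (1 - y) ^ (N - j) * (N.choose j)) := by
    intro j hj
    have hj' : j ≤ N := Nat.lt_succ_iff.1 (Finset.mem_range.1 hj)
    obtain ⟨k, rfl⟩ := Nat.exists_eq_add_of_le hj'
    have h2 : ∀ u ∈ D.level (D.deg a + j), D.birthFormula s a u * D.birthFormula t u b =
        (D.binom b u * D.binom u a) * ((D.dim b : ℝ) / D.dim a *
          (x ^ (finrank ℂ V + D.deg a) * (1 - x) ^ j *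
            y ^ (finrank ℂ V + (D.deg a + j)) * (1 - y) ^ k)) := by
      intro u hu
      have hu := D.mem_level.1 hu
      have hd : (D.dim u : ℝ) ≠ 0 := Nat.cast_ne_zero.2 (D.dim_pos u).ne'
      rw [D.birthFormula_eq hu, D.birthFormula_eq (a := u) (b := b) (k := k) (by omega), hu]
      have hdd : (D.dim u : ℝ) / D.dim a * (D.dim b / D.dim u) = D.dim b / D.dim a := by field_simp
      linear_combination (D.binom b u * D.binom u a * (x ^ (finrank ℂ V + D.deg a) * (1 - x) ^ j *
        y ^ (finrank ℂ V + (D.deg a + j)) * (1 - y) ^ k)) * hdd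
    rw [Finset.sum_congr rfl h2, ← Finset.sum_mul,
      D.sum_binom_mul_binom hord (k := k) (by omega), Nat.add_sub_cancel_left]
    simp only [mul_pow]
    ring
  rw [Finset.sum_congr rfl h1, ← Finset.mul_sum, ← add_pow]
  ring

theorem deathFormula_nonneg (hord : ∀ a b : Λ, D.deg a < D.deg b → a < b) {t : ℝ} (ht : 0 ≤ t)
    (a b : Λ) : 0 ≤ D.deathFormula t a b := by
  have h1 := D.binom_nonneg hord a b
  have h2 : 0 ≤ 1 - Real.exp (-t) := sub_nonneg.2 (Real.exp_le_one_iff.2 (neg_nonpos.2 ht))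
  unfold deathFormula
  split_ifs <;> positivity

theorem birthFormula_nonneg (hord : ∀ a b : Λ, D.deg a < D.deg b → a < b) {t : ℝ} (ht : 0 ≤ t)
    (a b : Λ) : 0 ≤ D.birthFormula t a b := by
  have h1 := D.binom_nonneg hord b a
  have h2 : 0 ≤ 1 - Real.exp (-t) := sub_nonneg.2 (Real.exp_le_one_iff.2 (neg_nonpos.2 ht))
  unfold birthFormula
  split_ifs <;> positivity

theorem deathFormula_zero (hord : ∀ a b : Λ, D.deg a < D.deg b → a < b) (a b : Λ) :
    D.deathFormula 0 a b = if a = b then 1 else 0 := by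
  rcases lt_or_ge (D.deg a) (D.deg b) with h | h
  · rw [D.deathFormula_of_lt h, if_neg (by rintro rfl; exact lt_irrefl _ h)]
  obtain ⟨k, hk⟩ := Nat.exists_eq_add_of_le h
  rw [D.deathFormula_eq hk]
  rcases k with _ | k
  · rw [D.binom_of_deg_eq hord hk]
    simp
  · rw [if_neg (by rintro rfl; omega)]
    simp

theorem birthFormula_zero (hord : ∀ a b : Λ, D.deg a < D.deg b → a < b) (a b : Λ) :
    D.birthFormula 0 a b = if a = b then 1 else 0 := by
  rcases lt_or_ge (D.deg b) (D.deg a) with h | h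
  · rw [D.birthFormula_of_lt h, if_neg (by rintro rfl; exact lt_irrefl _ h)]
  obtain ⟨k, hk⟩ := Nat.exists_eq_add_of_le h
  rw [D.birthFormula_eq hk]
  rcases k with _ | k
  · rw [D.binom_of_deg_eq hord hk]
    by_cases hab : a = b
    · subst hab
      have hd : (D.dim a : ℝ) ≠ 0 := Nat.cast_ne_zero.2 (D.dim_pos a).ne'
      simp [hd]
    · simp [hab, Ne.symm hab]
  · rw [if_neg (by rintro rfl; omega)]
    simp

theorem hasSum_deathFormula (hord : ∀ a b : Λ, D.deg a < D.deg b → a < b) (t : ℝ) (a : Λ) :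
    HasSum (D.deathFormula t a) 1 := by
  have h : HasSum (D.deathFormula t a) (∑ u ∈ D.between 0 (0 + D.deg a), D.deathFormula t a u) := by
    refine hasSum_sum_of_ne_finset_zero fun u hu => D.deathFormula_of_lt ?_ t
    by_contra hlt
    exact hu (D.mem_between.2 ⟨Nat.zero_le _, by omega⟩)
  convert h using 1
  rw [D.sum_between]
  set x := Real.exp (-t) with hx
  have h1 : ∀ j ∈ Finset.range (D.deg a + 1), ∑ u ∈ D.level (0 + j), D.deathFormula t a u =
      x ^ j * (1 - x) ^ (D.deg a - j) * ((D.deg a).choose j) := by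
    intro j hj
    have hj' : j ≤ D.deg a := Nat.lt_succ_iff.1 (Finset.mem_range.1 hj)
    obtain ⟨k, hk⟩ := Nat.exists_eq_add_of_le hj'
    have h2 : ∀ u ∈ D.level (0 + j), D.deathFormula t a u =
        D.binom a u * (x ^ j * (1 - x) ^ k) := by
      intro u hu
      have hu := D.mem_level.1 hu
      rw [D.deathFormula_eq (k := k) (by omega), hu, zero_add]
    rw [Finset.sum_congr rfl h2, ← Finset.sum_mul, zero_add, D.sum_binom hord hk, hk,
      Nat.add_sub_cancel_left]
    ring
  rw [Finset.sum_congr rfl h1, ← add_pow]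
  simp

theorem hasSum_birthFormula (hord : ∀ a b : Λ, D.deg a < D.deg b → a < b) {t : ℝ} (ht : 0 ≤ t)
    (a : Λ) : HasSum (D.birthFormula t a) 1 := by
  set g : ℕ → ℝ := fun m => ∑ u ∈ D.level m, D.birthFormula t a u with hg
  have hg1 : HasSum g 1 := by
    rw [← (add_right_injective (D.deg a)).hasSum_iff]
    · refine (hasSum_negBinomial (finrank ℂ V + D.deg a) (Real.exp_pos (-t))
        (Real.exp_le_one_iff.2 (neg_nonpos.2 ht))).congr_fun fun k => ?_
      rw [← D.sum_dim_mul_binom hord, Function.comp_apply, hg, Finset.sum_mul, Finset.sum_mul]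
      refine Finset.sum_congr rfl fun u hu => ?_
      rw [D.birthFormula_eq (D.mem_level.1 hu)]
      ring
    · intro m hm
      refine Finset.sum_eq_zero fun u hu => D.birthFormula_of_lt ?_ t
      rw [D.mem_level.1 hu]
      by_contra hlt
      exact hm ⟨m - D.deg a, by simp only; omega⟩
  have hfib : ∀ m, HasSum (fun u : {u // D.deg u = m} => D.birthFormula t a u) (g m) := by
    intro m
    have : Fintype {u // D.deg u = m} := Fintype.subtype (D.level m) fun u => D.mem_level
    rw [hg]
    simp only
    rw [Finset.sum_subtype (D.level m) (p := fun u => D.deg u = m) (fun u => D.mem_level)]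
    exact hasSum_fintype _
  rw [← (Equiv.sigmaFiberEquiv D.deg).hasSum_iff]
  refine HasSum.sigma_of_hasSum hg1 hfib ?_
  refine (summable_sigma_of_nonneg (f := D.birthFormula t a ∘ Equiv.sigmaFiberEquiv D.deg)
    fun u => D.birthFormula_nonneg hord ht a _).2 ⟨fun m => (hfib m).summable, ?_⟩
  exact hg1.summable.congr fun m => ((hfib m).tsum_eq).symm

theorem isTransitionSemigroup_deathFormula (hord : ∀ a b : Λ, D.deg a < D.deg b → a < b) :
    IsTransitionSemigroup D.deathFormula where
  nonneg _ ht := D.deathFormula_nonneg hord ht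
  summable t _ a := (D.hasSum_deathFormula hord t a).summable
  tsum_le_one t _ a := (D.hasSum_deathFormula hord t a).tsum_eq.le
  zero_self a := by rw [D.deathFormula_zero hord, if_pos rfl]
  zero_ne a b hab := by rw [D.deathFormula_zero hord, if_neg hab]
  hasSum_one t _ a := D.hasSum_deathFormula hord t a
  semigroup s t _ _ a b := by
    rw [D.deathFormula_semigroup hord]
    refine hasSum_sum_of_ne_finset_zero fun u hu => ?_
    by_cases h : D.deg u ≤ D.deg a
    · rw [D.deathFormula_of_lt (a := u), mul_zero]
      by_contra hlt
      exact hu (D.mem_between.2 ⟨by omega, h⟩)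
    · rw [D.deathFormula_of_lt (not_le.1 h), zero_mul]

theorem isTransitionSemigroup_birthFormula (hord : ∀ a b : Λ, D.deg a < D.deg b → a < b) :
    IsTransitionSemigroup D.birthFormula where
  nonneg _ ht := D.birthFormula_nonneg hord ht
  summable _ ht a := (D.hasSum_birthFormula hord ht a).summable
  tsum_le_one _ ht a := (D.hasSum_birthFormula hord ht a).tsum_eq.le
  zero_self a := by rw [D.birthFormula_zero hord, if_pos rfl]
  zero_ne a b hab := by rw [D.birthFormula_zero hord, if_neg hab]
  hasSum_one _ ht a := D.hasSum_birthFormula hord ht a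
  semigroup s t _ _ a b := by
    rw [D.birthFormula_semigroup hord]
    refine hasSum_sum_of_ne_finset_zero fun u hu => ?_
    by_cases h : D.deg u ≤ D.deg b
    · rw [D.birthFormula_of_lt (b := u), zero_mul]
      by_contra hlt
      exact hu (D.mem_between.2 ⟨by omega, h⟩)
    · rw [D.birthFormula_of_lt (not_le.1 h), mul_zero]

theorem hasTransitionRates_deathFormula (hord : ∀ a b : Λ, D.deg a < D.deg b → a < b) :
    HasTransitionRates D.deathFormula D.deathRate := by
  intro a b
  refine HasDerivAt.hasDerivWithinAt ?_
  rcases lt_or_ge (D.deg a) (D.deg b) with h | h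
  · simp only [D.deathFormula_of_lt h]
    rw [deathRate, if_neg (by omega), if_neg (by rintro rfl; exact lt_irrefl _ h)]
    exact hasDerivAt_const _ _
  obtain ⟨k, hk⟩ := Nat.exists_eq_add_of_le h
  simp only [D.deathFormula_eq hk]
  refine (hasDerivAt_exp_pow_mul _ _ _).congr_deriv ?_
  rcases k with _ | _ | k
  · rw [show D.deathRate a b = _ from if_neg (by omega), D.binom_of_deg_eq hord hk, hk]
    by_cases hab : a = b <;> simp [hab]
  · rw [show D.deathRate a b = _ from if_pos (by omega)]
    simp
  · rw [show D.deathRate a b = _ from (if_neg (by omega)).trans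
      (if_neg (by rintro rfl; omega))]
    simp

theorem hasTransitionRates_birthFormula (hord : ∀ a b : Λ, D.deg a < D.deg b → a < b) :
    HasTransitionRates D.birthFormula D.birthRate := by
  intro a b
  refine HasDerivAt.hasDerivWithinAt ?_
  rcases lt_or_ge (D.deg b) (D.deg a) with h | h
  · simp only [D.birthFormula_of_lt h]
    rw [birthRate, if_neg (by omega), if_neg (by rintro rfl; exact lt_irrefl _ h)]
    exact hasDerivAt_const _ _
  obtain ⟨k, hk⟩ := Nat.exists_eq_add_of_le h
  simp only [D.birthFormula_eq hk]
  refine (hasDerivAt_exp_pow_mul _ _ _).congr_deriv ?_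
  rcases k with _ | _ | k
  · rw [show D.birthRate a b = _ from if_neg (by omega), D.binom_of_deg_eq hord hk]
    by_cases hab : a = b
    · subst hab
      have hd : (D.dim a : ℝ) ≠ 0 := Nat.cast_ne_zero.2 (D.dim_pos a).ne'
      simp [hd]
      ring
    · simp [hab, Ne.symm hab]
  · rw [show D.birthRate a b = _ from if_pos (by omega)]
    simp
  · rw [show D.birthRate a b = _ from (if_neg (by omega)).trans
      (if_neg (by rintro rfl; omega))]
    simp

/-- The death formula is the only transition function with its rates. The forward equation for
`p_t(a, b)` involves only states of degree between `|b|` and `|a|`, since the death formula vanishes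
at states of higher degree; the rank is the number of degrees lost since the start. -/
theorem eq_deathFormula (hord : ∀ a b : Λ, D.deg a < D.deg b → a < b) {p : ℝ → Λ → Λ → ℝ}
    (hp : IsTransitionFunction p) (hpr : HasTransitionRates p D.deathRate) {t : ℝ} (ht : 0 ≤ t)
    (a b : Λ) : p t a b = D.deathFormula t a b := by
  refine (D.isTransitionSemigroup_deathFormula hord).eq_of_hasTransitionRates
    (D.hasTransitionRates_deathFormula hord) hp hpr a
    (fun b => D.between (D.deg b) (D.deg a))
    (fun b s h _ _ => D.deathFormula_semigroup hord s h a b)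
    (fun b hb t _ => D.deathFormula_of_lt ?_ t) (fun u => D.deg a - D.deg u)
    (fun b u hu hub hr => ?_) ht b
  · by_contra hlt
    exact hb (D.mem_between.2 ⟨le_rfl, not_lt.1 hlt⟩)
  · have hu' := D.mem_between.1 hu
    rw [deathRate, if_neg hub] at hr
    have : D.deg u = D.deg b + 1 := by
      by_contra hne
      exact hr (if_neg hne)
    omega

/-- The birth formula is the only transition function with its rates. -/
theorem eq_birthFormula (hord : ∀ a b : Λ, D.deg a < D.deg b → a < b) {p : ℝ → Λ → Λ → ℝ}
    (hp : IsTransitionFunction p) (hpr : HasTransitionRates p D.birthRate) {t : ℝ} (ht : 0 ≤ t)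
    (a b : Λ) : p t a b = D.birthFormula t a b := by
  refine (D.isTransitionSemigroup_birthFormula hord).eq_of_hasTransitionRates
    (D.hasTransitionRates_birthFormula hord) hp hpr a
    (fun b => D.between (D.deg a) (D.deg b))
    (fun b s h _ _ => D.birthFormula_semigroup hord s h a b)
    (fun b hb t _ => D.birthFormula_of_lt ?_ t) D.deg (fun b u hu hub hr => ?_) ht b
  · by_contra hlt
    exact hb (D.mem_between.2 ⟨not_lt.1 hlt, le_rfl⟩)
  · rw [birthRate, if_neg hub] at hr
    have : D.deg b = D.deg u + 1 := by
      by_contra hne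
      exact hr (if_neg hne)
    omega

end MultFreeDecomposition

end MultFree

end

theorem theorem3p1 {V : Type*} [NormedAddCommGroup V] [InnerProductSpace ℂ V] [CompleteSpace V]
    [FiniteDimensional ℂ V] [MeasurableSpace V] [BorelSpace V]
    (K : Subgroup (unitary (V →L[ℂ] V))) (hK : IsClosed (K : Set (unitary (V →L[ℂ] V))))
    {Λ : Type*} [LinearOrder Λ] [LocallyFiniteOrderBot Λ] [WellFoundedLT Λ]
    (D : MultFree.MultFreeDecomposition K Λ)
    (hord : ∀ a b : Λ, D.deg a < D.deg b → a < b) :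
    (MultFree.IsTransitionSemigroup D.birthFormula ∧
      MultFree.HasTransitionRates D.birthFormula D.birthRate ∧
      ∀ p : ℝ → Λ → Λ → ℝ, MultFree.IsTransitionFunction p →
        MultFree.HasTransitionRates p D.birthRate →
        ∀ t, 0 ≤ t → ∀ a b, p t a b = D.birthFormula t a b) ∧
    (MultFree.IsTransitionSemigroup D.deathFormula ∧
      MultFree.HasTransitionRates D.deathFormula D.deathRate ∧
      ∀ p : ℝ → Λ → Λ → ℝ, MultFree.IsTransitionFunction p →
        MultFree.HasTransitionRates p D.deathRate →
        ∀ t, 0 ≤ t → ∀ a b, p t a b = D.deathFormula t a b) := by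
  refine ⟨⟨D.isTransitionSemigroup_birthFormula hord, D.hasTransitionRates_birthFormula hord,
    fun p hp hpr t ht a b => D.eq_birthFormula hord hp hpr ht a b⟩,
    D.isTransitionSemigroup_deathFormula hord, D.hasTransitionRates_deathFormula hord,
    fun p hp hpr t ht a b => D.eq_deathFormula hord hp hpr ht a b⟩
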